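/- **Setting.** Base stations (BSs) form a homogeneous Poisson point process (PPP) of intensity $\lambda_B>0$ in the plane; users have density $\lambda_D>0$, each has a packet with probability $p_a\in[0,1]$ and uses one of $S\ge 1$ orthogonal pilots, so that $\lambda_a=p_a\lambda_D/S$ is the density of users with a packet on a given pilot. In each round trip $m=1,2,\dots$ an active user sends $K\ge1$ repetitions of its packet, with full path-loss inversion: a user at distance $R$ from its serving BS transmits with power $g_m\rho R^{\alpha}$ (path-loss exponent $\alpha>2$, $\rho>0$, power level $g_m>0$). The noise power is $\sigma^2\ge 0$, the SINR threshold is $\gamma_{\rm th}>0$, and all channel power gains are i.i.d. $\mathrm{Exp}(1)$. Let $\mathcal P_m$ be the access success probability of the typical (active) user in round trip $m$, and let the active probabilities be $\mathcal A_1=1$, $\mathcal A_m=1-\sum_{i=1}^{m-1}\mathcal A_i\mathcal P_i$ for $m\ge2$. Round trip $m$ is modelled as follows. 1. The number $N$ of other active users with the same pilot in the typical user's cell is mixed Poisson: given the area $|V|$ of this cell, $N$ is Poisson with mean $\mathcal A_m\lambda_a|V|$. Here $\lambda_B|V|$ follows the size-biased version of the gamma law with shape and rate $c=3.575$ (the usual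 gamma approximation of the Poisson–Voronoi cell area). 2. In the reception of a user by the BS, placed at the origin, the repetition $r\in\{1,\dots,K\}$ has $$\mathrm{SINR}_r=\frac{g_m\rho h_{0}^r}{\sum_{\beta=1}^{N} g_m\rho h_\beta^r+\sum_i g_m\rho R_i^{\alpha}h_i^r\|u_i\|^{-\alpha}+\sigma^2},$$ where $h_0^r$ is the gain of that user and $h_\beta^r$ are those of the other $N$ users of the cell. The inter-cell interferers $u_i$ come from a PPP of intensity $\mathcal A_m\lambda_a$ with i.i.d. marks $(R_i,(h_i^r)_{r\le K})$, where $R_i$ has the law of the distance from a fixed point to the nearest BS, and only points with $\|u_i\|>R_i$ are kept. Positions are the same for all $K$ repetitions, gains are independent over repetitions; $N$, the gains $h_0^r,h_\beta^r$ and the marked interferer process are independent. 3. The receptions of the $N+1$ users of the cell are decoupled: each is described by its own copy of the gains and of the interferer process, and these copies are independent of each other and of $N$. The transmission of a user is successful if $\mathrm{SINR}_r\ge\gamma_{\rm th}$ for at least one $r\le K$. The access of the typical user succeeds if its transmission is successful and the transmission of none of the $N$ other users is (no collision). **Statement.** For every $m\ge1$: (I) for all $n\ge 0$, $$\mathbb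 P[N=n]=\mathrm O[n,m]:=\frac{c^{c+1}\,\Gamma(n+c+1)\,(\mathcal A_m\lambda_a/\lambda_B)^n}{\Gamma(c+1)\,\Gamma(n+1)\,(\mathcal A_m\lambda_a/\lambda_B+c)^{n+c+1}};$$ (II) for all $n$ with $\mathbb P[N=n]>0$, the conditional probability given $N=n$ that the typical user's transmission is successful is $$\Theta[n,m,K]:=\sum_{k=1}^{K}(-1)^{k+1}\binom Kk \exp\Big(-\frac{k\gamma_{\rm th}\sigma^2}{g_m\rho}\Big)(1+\gamma_{\rm th})^{-kn}\exp\Big(-\frac{\mathcal A_m\lambda_a}{\lambda_B}\Big({}_2F_1\Big(-\frac2\alpha,k;\frac{\alpha-2}\alpha;-\gamma_{\rm th}\Big)-1\Big)\Big),$$ where ${}_2F_1$ is the Gauss hypergeometric function (continued analytically along the negative real axis); (III) for the same $n$, the conditional probability given $N=n$ that there is no collision is $(1-\Theta[n,m,K])^n$; and $$\mathcal P_m=\sum_{n=0}^\infty \mathrm O[n,m]\;\Theta[n,m,K]\;\big(1-\Theta[n,m,K]\big)^n .$$ -/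

import Mathlib

open MeasureTheory ProbabilityTheory Set
open scoped ENNReal Topology

noncomputable section

/-! ### The Gauss hypergeometric function on the real line -/

/-- The Gauss hypergeometric function `₂F₁(a, b; c; z)` at a real point `z`: the value at `z` of the
analytic continuation, along the segment from `0` to `z`, of the hypergeometric power series
(Mathlib's `ordinaryHypergeometric`, which is only meaningful inside the unit disc). -/
def gaussHyp (a b c z : ℝ) : ℝ :=
  open Classical in
  if h : ∃ F : ℝ → ℝ, AnalyticOnNhd ℝ F (uIcc 0 z) ∧
      F =ᶠ[𝓝 0] (ordinaryHypergeometric a b c : ℝ → ℝ)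
  then h.choose z else 0

/-- The continuation is unique, so `gaussHyp` does not depend on the choice made in it. -/
theorem gaussHyp_eq {a b c z : ℝ} {F : ℝ → ℝ} (hF : AnalyticOnNhd ℝ F (uIcc 0 z))
    (h0 : F =ᶠ[𝓝 0] (ordinaryHypergeometric a b c : ℝ → ℝ)) : gaussHyp a b c z = F z := by
  have h : ∃ F : ℝ → ℝ, AnalyticOnNhd ℝ F (uIcc 0 z) ∧
      F =ᶠ[𝓝 0] (ordinaryHypergeometric a b c : ℝ → ℝ) := ⟨F, hF, h0⟩
  rw [gaussHyp, dif_pos h]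
  exact h.choose_spec.1.eqOn_of_preconnected_of_eventuallyEq hF isPreconnected_uIcc
    left_mem_uIcc (h.choose_spec.2.trans h0.symm) right_mem_uIcc

/-- Inside the unit disc, `gaussHyp` is the sum of the hypergeometric power series. -/
theorem gaussHyp_eq_series {a b c z : ℝ} (hz : |z| < 1)
    (h : ∀ k : ℕ, (k : ℝ) ≠ -a ∧ (k : ℝ) ≠ -b ∧ (k : ℝ) ≠ -c) :
    gaussHyp a b c z = ordinaryHypergeometric a b c z := by
  have hr := ordinaryHypergeometricSeries_radius_eq_one ℝ a b c h
  have hp := (ordinaryHypergeometricSeries ℝ a b c).hasFPowerSeriesOnBall (by rw [hr]; simp)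
  refine gaussHyp_eq (fun w hw => ?_) Filter.EventuallyEq.rfl
  refine hp.analyticAt_of_mem ?_
  rw [hr, Metric.mem_eball, edist_zero_right, ← ofReal_norm, Real.norm_eq_abs,
    ENNReal.ofReal_lt_one]
  have hw' := abs_sub_left_of_mem_uIcc hw
  simp only [sub_zero] at hw'
  exact lt_of_le_of_lt hw' hz

/-! ### Poisson point processes -/

/-- `Φ` is a Poisson point process on `E` with intensity measure `Λ`: the number of points of `Φ` in
a set of finite intensity is Poisson distributed, and the numbers of points in disjoint sets are
independent. -/
structure IsPoissonProcess {Ω E : Type*} [MeasurableSpace Ω] [MeasurableSpace E]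
    (P : Measure Ω) (Φ : Ω → Measure E) (Λ : Measure E) : Prop where
  measurable : Measurable Φ
  law : ∀ B : Set E, MeasurableSet B → Λ B ≠ ∞ → ∀ k : ℕ,
    P {ω | Φ ω B = (k : ℝ≥0∞)} = poissonMeasure (Λ B).toNNReal {k}
  indep : ∀ (n : ℕ) (B : Fin n → Set E), (∀ i, MeasurableSet (B i)) →
    (∀ i j, i ≠ j → Disjoint (B i) (B j)) → iIndepFun (fun i ω => Φ ω (B i)) P

/-! ### The network -/

/-- The Euclidean plane. -/
abbrev Plane : Type := EuclideanSpace ℝ (Fin 2)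

/-- Parameters of the network. -/
structure NetworkParams where
  /-- intensity of the base stations -/
  lamB : ℝ
  /-- intensity of the users -/
  lamD : ℝ
  /-- packet arrival probability -/
  pa : ℝ
  /-- number of orthogonal pilots -/
  S : ℕ
  /-- number of repetitions in a round trip -/
  K : ℕ
  /-- path-loss exponent -/
  α : ℝ
  /-- power control threshold -/
  ρ : ℝ
  /-- SINR threshold -/
  γ : ℝ
  /-- standard deviation of the noise (the noise power is `σ ^ 2`) -/
  σ : ℝ
  /-- `g m` is the power level unit in the `m`-th round trip -/
  g : ℕ → ℝ
  lamB_pos : 0 < lamB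
  lamD_pos : 0 < lamD
  pa_mem : pa ∈ Icc (0 : ℝ) 1
  S_pos : 0 < S
  K_pos : 0 < K
  α_gt : 2 < α
  ρ_pos : 0 < ρ
  γ_pos : 0 < γ
  g_pos : ∀ m, 1 ≤ m → 0 < g m

/-- The density of the users that have a packet and choose a given pilot. -/
def NetworkParams.lamA (p : NetworkParams) : ℝ := p.pa * p.lamD / p.S

/-- The shape constant of the gamma approximation of the area of a Poisson-Voronoi cell. -/
def cellShape : ℝ := 3.575

/-- The law of the normalised area (area times `lamB`) of the cell that contains a typical user.
The normalised area of a typical cell has the gamma law with shape and rate `cellShape` (and mean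
`1`); the cell that contains a typical user is the size-biased one. -/
def userCellArea : Measure ℝ :=
  (gammaMeasure cellShape cellShape).withDensity (fun x => ENNReal.ofReal x)

/-- The distance from the origin to the nearest point of a configuration of points. -/
def nearestDist (φ : Measure Plane) : ℝ := sInf {r : ℝ | 0 < r ∧ φ (Metric.ball 0 r) ≠ 0}

/-- An inter-cell interferer: its position, relative to the base station at the origin; the distance
to its own serving base station; its channel gains towards the origin in the `K` repetitions. -/
abbrev Interferer (K : ℕ) : Type := Plane × ℝ × (Fin K → ℝ)

/-- The intensity measure of the inter-cell interferers: the positions have density `lam`, each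
position carries an independent mark made of a serving distance with law `servDist` and of `K`
independent `Exp(1)` gains, and only users closer to their own base station than to the origin
are kept. -/
def interfererIntensity (K : ℕ) (lam : ℝ) (servDist : Measure ℝ) : Measure (Interferer K) :=
  (ENNReal.ofReal lam • ((volume : Measure Plane).prod
    (servDist.prod (Measure.pi fun _ : Fin K => expMeasure 1)))).restrict {x | x.2.1 < ‖x.1‖}

/-- What enters the reception of one user at its base station, besides the number of other users
in the cell: the gains (`e.1 0 r` is the gain of the user itself in repetition `r`, and `e.1 β r`
with `1 ≤ β` is the gain of the `β`-th other user of the cell) and the inter-cell interferers. -/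
abbrev Reception (K : ℕ) : Type := (ℕ → Fin K → ℝ) × Measure (Interferer K)

/-- The inter-cell interference in repetition `r` of round trip `m`: an interferer with serving
distance `R`, gain `h` and position `u` transmits with power `g m * ρ * R ^ α` and is received with
power `g m * ρ * R ^ α * h * ‖u‖ ^ (-α)`. -/
def interInterference (p : NetworkParams) (m : ℕ) (φ : Measure (Interferer p.K)) (r : Fin p.K) :
    ℝ≥0∞ :=
  ∫⁻ x, ENNReal.ofReal (p.g m * (p.ρ * x.2.1 ^ p.α) * x.2.2 r * ‖x.1‖ ^ (-p.α)) ∂φ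

/-- The intra-cell interference in repetition `r` of round trip `m` caused by `n` other users. -/
def intraInterference (p : NetworkParams) (m n : ℕ) (h : ℕ → Fin p.K → ℝ) (r : Fin p.K) : ℝ≥0∞ :=
  ∑ β ∈ Finset.Icc 1 n, ENNReal.ofReal (p.g m * p.ρ * h β r)

/-- The SINR of repetition `r` in round trip `m` when there are `n` other users in the cell. -/
def sinr (p : NetworkParams) (m n : ℕ) (e : Reception p.K) (r : Fin p.K) : ℝ≥0∞ :=
  ENNReal.ofReal (p.g m * p.ρ * e.1 0 r) /
    (intraInterference p m n e.1 r + interInterference p m e.2 r + ENNReal.ofReal (p.σ ^ 2))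

section Events

variable {Ω : Type*}

/-- The event that, in round trip `m`, the transmission of the `j`-th user of the cell is received:
at least one of its `K` repetitions reaches the SINR threshold. User `0` is the typical user, the
users `1, …, N m` are the other users of its cell. -/
def transmissionSuccess (p : NetworkParams) (N : ℕ → Ω → ℕ) (env : ℕ → ℕ → Ω → Reception p.K)
    (m j : ℕ) : Set Ω :=
  {ω | ∃ r : Fin p.K, ENNReal.ofReal p.γ ≤ sinr p m (N m ω) (env m j ω) r}

/-- The event that no transmission of another user of the cell is received in round trip `m`. -/
def noCollision (p : NetworkParams) (N : ℕ → Ω → ℕ) (env : ℕ → ℕ → Ω → Reception p.K)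
    (m : ℕ) : Set Ω :=
  {ω | ∀ j, 1 ≤ j → j ≤ N m ω → ω ∉ transmissionSuccess p N env m j}

/-- The event that the access of the typical user succeeds in round trip `m`. -/
def accessSuccess (p : NetworkParams) (N : ℕ → Ω → ℕ) (env : ℕ → ℕ → Ω → Reception p.K)
    (m : ℕ) : Set Ω :=
  transmissionSuccess p N env m 0 ∩ noCollision p N env m

variable [MeasurableSpace Ω]

/-- The access success probability of the typical user in round trip `m`. -/
def accessProb (p : NetworkParams) (P : Measure Ω) (N : ℕ → Ω → ℕ)
    (env : ℕ → ℕ → Ω → Reception p.K) (m : ℕ) : ℝ :=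
  P.real (accessSuccess p N env m)

end Events

/-- The active probability in round trip `m ≥ 1`, when `q i` is the access success probability in
round trip `i`: it is `1` for `m = 1` and `1 - ∑ i < m, activeProb q i * q i` in general. -/
def activeProb (q : ℕ → ℝ) (m : ℕ) : ℝ :=
  1 - ∑ i ∈ (Finset.Icc 1 (m - 1)).attach, activeProb q i.1 * q i.1
termination_by m
decreasing_by
  have := Finset.mem_Icc.1 i.2
  omega

theorem activeProb_eq (q : ℕ → ℝ) (m : ℕ) :
    activeProb q m = 1 - ∑ i ∈ Finset.Icc 1 (m - 1), activeProb q i * q i := by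
  rw [activeProb, Finset.sum_attach (Finset.Icc 1 (m - 1)) (fun i => activeProb q i * q i)]

theorem activeProb_one (q : ℕ → ℝ) : activeProb q 1 = 1 := by
  simp [activeProb_eq q 1]

/-- The active probability of a user in round trip `m`. -/
def activity {Ω : Type*} [MeasurableSpace Ω] (p : NetworkParams) (P : Measure Ω)
    (N : ℕ → Ω → ℕ) (env : ℕ → ℕ → Ω → Reception p.K) (m : ℕ) : ℝ :=
  activeProb (accessProb p P N env) m

/-- The stochastic model of the K-repetition scheme. `ΦB` are the base stations, `N m` is the number
of other active users with the same pilot in the cell of the typical user in round trip `m`, and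
`env m j` contains the gains and the inter-cell interferers that enter the reception of the `j`-th
user of the cell in round trip `m`. -/
structure IsKRepModel {Ω : Type*} [MeasurableSpace Ω] (p : NetworkParams) (P : Measure Ω)
    (ΦB : Ω → Measure Plane) (N : ℕ → Ω → ℕ) (env : ℕ → ℕ → Ω → Reception p.K) : Prop where
  /-- The base stations form a homogeneous Poisson point process. -/
  base : IsPoissonProcess P ΦB (ENNReal.ofReal p.lamB • volume)
  measurable_N : ∀ m, 1 ≤ m → Measurable (N m)
  /-- Given the area of the cell of the typical user, the number of other active users in it is
  Poisson distributed, with mean the area times the density of these users. -/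
  law_N : ∀ m, 1 ≤ m → ∀ n : ℕ, P {ω | N m ω = n} =
    ∫⁻ x, poissonMeasure (activity p P N env m * p.lamA * (x / p.lamB)).toNNReal {n} ∂userCellArea
  measurable_env : ∀ m, 1 ≤ m → ∀ j, Measurable (env m j)
  /-- All gains are `Exp(1)` distributed (Rayleigh fading) ... -/
  law_gain : ∀ m, 1 ≤ m → ∀ j β r, P.map (fun ω => (env m j ω).1 β r) = expMeasure 1
  /-- ... and independent of each other. -/
  indep_gain : ∀ m, 1 ≤ m → ∀ j,
    iIndepFun (fun (i : ℕ × Fin p.K) ω => (env m j ω).1 i.1 i.2) P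
  /-- The inter-cell interferers form an independently marked Poisson point process whose serving
  distances are distributed as the distance to the nearest base station. -/
  inter : ∀ m, 1 ≤ m → ∀ j, IsPoissonProcess P (fun ω => (env m j ω).2)
    (interfererIntensity p.K (activity p P N env m * p.lamA)
      (P.map fun ω => nearestDist (ΦB ω)))
  indep_inter : ∀ m, 1 ≤ m → ∀ j,
    IndepFun (fun ω => (env m j ω).1) (fun ω => (env m j ω).2) P
  /-- The receptions of different users of the cell are decoupled. -/
  indep_users : ∀ m, 1 ≤ m → iIndepFun (fun j => env m j) P
  indep_N : ∀ m, 1 ≤ m → IndepFun (N m) (fun ω j => env m j ω) P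

/-! ### The closed forms -/

/-- The closed form `O[n, m]`, with `A` in the place of the active probability. -/
def numberForm (p : NetworkParams) (A : ℝ) (n : ℕ) : ℝ :=
  cellShape ^ (cellShape + 1) * Real.Gamma (n + cellShape + 1) * (A * p.lamA / p.lamB) ^ n /
    (Real.Gamma (cellShape + 1) * Real.Gamma (n + 1) *
      (A * p.lamA / p.lamB + cellShape) ^ (n + cellShape + 1))

/-- The closed form `Θ[n, m, K]`, with `A` in the place of the active probability. -/
def thetaForm (p : NetworkParams) (A : ℝ) (n m : ℕ) : ℝ :=
  ∑ k ∈ Finset.Icc 1 p.K, (-1 : ℝ) ^ (k + 1) * (p.K.choose k : ℝ) *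
    Real.exp (-(k * p.γ * p.σ ^ 2 / (p.g m * p.ρ))) * (1 + p.γ) ^ (-((k * n : ℕ) : ℤ)) *
    Real.exp (-(A * p.lamA / p.lamB *
      (gaussHyp (-2 / p.α) k ((p.α - 2) / p.α) (-p.γ) - 1)))

end

/-! On the event that there are `n` other users, success and collision depend only on the
receptions. These are independent of each other and of the number of users, and each decodes with
the same probability Θ. So everything reduces to the law of `N` and to Θ; the series for the access
probability then follows by splitting over the values of `N`.

The law of `N` is a gamma integral: a Poisson weight times the size-biased gamma density is again a
gamma kernel (`lintegral_poisson_userCellArea`).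

For Θ, inclusion-exclusion over the repetitions leaves the probability that all repetitions in a set
`u` of size `k` reach the threshold. Solved for the user's own gain, the condition says that an
`Exp(1)` variable exceeds γ times the normalised interference plus noise, so the probability is the
mean of the exponential of minus that quantity. Noise contributes a constant, and each of the `n *
k` intra-cell gains contributes `1 / (1 + γ)` (`measure_gains_le`).

The inter-cell part does not factor over repetitions, because the positions are shared. It is a
single Laplace functional of a Poisson process, exp(-∫ (1 - e^{-f}) dΛ)
(`IsPoissonProcess.lintegral_expNeg_lintegral`), with `f` summed over `u`. Averaging over gains
gives 1 - (1 + γ (R/‖u‖)^α)^{-k}. Full path-loss inversion makes this a function of ‖u‖/R alone, so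
integration over the plane gives R² times a constant (`lintegral_plane_eq`). The mean of R² is 1/(π
λ_B), from the void probabilities of the base stations
(`IsPoissonProcess.lintegral_nearestDist_sq`). The constant is π(₂F₁ - 1), by an integral
representation checked on the power series and carried to -γ by analyticity
(`gaussHyp_neg_two_div`).

Interference takes values in `[0, ∞]`, with exp(-∞) = 0, so its almost sure finiteness is never
needed. -/

/-! ### The decreasing exponential on `[0, ∞]` -/

/-- `exp (-x)` for `x ∈ [0, ∞]`. -/
noncomputable def expNeg (x : ℝ≥0∞) : ℝ≥0∞ := EReal.exp (-(x : EReal))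

theorem expNeg_ofReal {x : ℝ} (hx : 0 ≤ x) :
    expNeg (ENNReal.ofReal x) = ENNReal.ofReal (Real.exp (-x)) := by
  rw [expNeg, EReal.coe_ennreal_ofReal, max_eq_left hx, ← EReal.coe_neg, EReal.exp_coe]

@[simp] theorem expNeg_zero : expNeg 0 = 1 := by simp [expNeg]

@[simp] theorem expNeg_top : expNeg ∞ = 0 := by simp [expNeg]

theorem expNeg_antitone : Antitone expNeg := fun _ _ h =>
  EReal.exp_monotone (EReal.neg_le_neg_iff.2 (EReal.coe_ennreal_le_coe_ennreal_iff.2 h))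

theorem expNeg_le_one (x : ℝ≥0∞) : expNeg x ≤ 1 := by
  simpa using expNeg_antitone (zero_le : 0 ≤ x)

theorem continuous_expNeg : Continuous expNeg :=
  EReal.expHomeomorph.continuous.comp (continuous_neg.comp continuous_coe_ennreal_ereal)

@[fun_prop]
theorem measurable_expNeg : Measurable expNeg := continuous_expNeg.measurable

theorem expNeg_add (x y : ℝ≥0∞) : expNeg (x + y) = expNeg x * expNeg y := by
  rw [expNeg, EReal.coe_ennreal_add, EReal.neg_add, sub_eq_add_neg, EReal.exp_add, expNeg, expNeg]
  · left; simp
  · right; simp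

theorem expNeg_sum {ι : Type*} (s : Finset ι) (f : ι → ℝ≥0∞) :
    expNeg (∑ i ∈ s, f i) = ∏ i ∈ s, expNeg (f i) := by
  classical
  induction s using Finset.induction_on with
  | empty => simp
  | insert a s ha ih => rw [Finset.sum_insert ha, Finset.prod_insert ha, expNeg_add, ih]

theorem expNeg_mul_natCast (x : ℝ≥0∞) (n : ℕ) : expNeg (x * n) = expNeg x ^ n := by
  induction n with
  | zero => simp
  | succ n ih => rw [Nat.cast_succ, mul_add, mul_one, expNeg_add, ih, pow_succ]

/-! ### The Laplace functional of a Poisson point process -/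

section Laplace

variable {Ω E : Type*} [MeasurableSpace Ω] [MeasurableSpace E]
  {P : Measure Ω} {Φ : Ω → Measure E} {Λ : Measure E}

theorem IsPoissonProcess.measurable_apply (h : IsPoissonProcess P Φ Λ) {B : Set E}
    (hB : MeasurableSet B) : Measurable fun ω => Φ ω B :=
  (Measure.measurable_coe hB).comp h.measurable

/-- The probability generating function of the Poisson law. -/
theorem tsum_poissonMeasure_mul_pow (r : ℝ≥0∞) (hr : r ≠ ∞) {q : ℝ≥0∞} (hq : q ≤ 1) :
    ∑' k : ℕ, poissonMeasure r.toNNReal {k} * q ^ k = expNeg ((1 - q) * r) := by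
  have hq' : q ≠ ∞ := ne_top_of_le_ne_top ENNReal.one_ne_top hq
  lift r to NNReal using hr
  lift q to NNReal using hq'
  have hq1 : (q : ℝ) ≤ 1 := by exact_mod_cast hq
  have h1 : ∀ k : ℕ, poissonMeasure (r : ℝ≥0∞).toNNReal {k} * (q : ℝ≥0∞) ^ k =
      ENNReal.ofReal (Real.exp (-r) * ((r * q : ℝ) ^ k / k.factorial)) := by
    intro k
    rw [ENNReal.toNNReal_coe, poissonMeasure_singleton, ← ENNReal.ofReal_coe_nnreal (p := q),
      ← ENNReal.ofReal_pow q.coe_nonneg, ← ENNReal.ofReal_mul (by positivity)]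
    congr 1
    rw [mul_pow]; ring
  have h2 : HasSum (fun k : ℕ => Real.exp (-r) * ((r * q : ℝ) ^ k / k.factorial))
      (Real.exp (-r) * Real.exp (r * q)) := by
    refine HasSum.mul_left _ ?_
    rw [Real.exp_eq_exp_ℝ]
    exact NormedSpace.expSeries_div_hasSum_exp (r * q : ℝ)
  have h3 : (1 - (q : ℝ≥0∞)) * r = ENNReal.ofReal ((1 - q) * r) := by
    rw [ENNReal.ofReal_mul (by linarith), ENNReal.ofReal_sub _ q.coe_nonneg]; simp
  simp_rw [h1]
  rw [← ENNReal.ofReal_tsum_of_nonneg (fun k => by positivity) h2.summable, h2.tsum_eq, h3,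
    expNeg_ofReal (mul_nonneg (by linarith) r.coe_nonneg), ← Real.exp_add]
  congr 2; ring

variable [IsProbabilityMeasure P]

/-- The Poisson weights sum to one (the generating function at `q = 1`), so no mass is left for
non-integer or infinite values. -/
theorem IsPoissonProcess.ae_mem_range (h : IsPoissonProcess P Φ Λ) {B : Set E}
    (hB : MeasurableSet B) (hΛ : Λ B ≠ ∞) : ∀ᵐ ω ∂P, ∃ k : ℕ, Φ ω B = k := by
  have hm : ∀ k : ℕ, MeasurableSet {ω | Φ ω B = (k : ℝ≥0∞)} := fun k =>
    h.measurable_apply hB (measurableSet_singleton _)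
  have hU : P (⋃ k : ℕ, {ω | Φ ω B = (k : ℝ≥0∞)}) = 1 := by
    rw [measure_iUnion _ hm]
    · simp_rw [h.law B hB hΛ]
      have := tsum_poissonMeasure_mul_pow (Λ B) hΛ (le_refl 1)
      simpa using this
    · intro i j hij
      refine Set.disjoint_left.2 fun ω h1 h2 => hij ?_
      have : (i : ℝ≥0∞) = j := h1.symm.trans h2
      exact_mod_cast this
  have := (prob_compl_eq_zero_iff (MeasurableSet.iUnion hm)).2 hU
  filter_upwards [compl_mem_ae_iff.2 this] with ω hω
  simpa using hω

/-- Splitting over the value of the count turns this into the Poisson generating function at `q =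
expNeg a`. -/
theorem IsPoissonProcess.lintegral_expNeg_mul (h : IsPoissonProcess P Φ Λ) {B : Set E}
    (hB : MeasurableSet B) (hΛ : Λ B ≠ ∞) (a : ℝ≥0∞) :
    ∫⁻ ω, expNeg (a * Φ ω B) ∂P = expNeg ((1 - expNeg a) * Λ B) := by
  have hm : ∀ k : ℕ, MeasurableSet {ω | Φ ω B = (k : ℝ≥0∞)} := fun k =>
    h.measurable_apply hB (measurableSet_singleton _)
  have h1 : (fun ω => expNeg (a * Φ ω B)) =ᵐ[P] fun ω =>
      ∑' k : ℕ, {ω | Φ ω B = (k : ℝ≥0∞)}.indicator (fun _ => expNeg a ^ k) ω := by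
    filter_upwards [h.ae_mem_range hB hΛ] with ω ⟨k, hk⟩
    rw [tsum_eq_single k]
    · simp [hk, expNeg_mul_natCast]
    · intro j hj
      refine Set.indicator_of_notMem ?_ _
      simp only [Set.mem_ofPred_eq, hk]
      exact_mod_cast hj.symm
  rw [lintegral_congr_ae h1, lintegral_tsum fun k =>
    (measurable_const.indicator (hm k)).aemeasurable]
  simp_rw [lintegral_indicator_const (hm _), h.law B hB hΛ]
  rw [← tsum_poissonMeasure_mul_pow _ hΛ (expNeg_le_one a)]
  simp_rw [mul_comm]

/-- The level sets of a simple function are disjoint, so their counts are independent and the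
transform is a product of one-set transforms. The level 0 contributes nothing to either integral and
is dropped, since its level set may have infinite intensity. -/
theorem IsPoissonProcess.lintegral_expNeg_simpleFunc (h : IsPoissonProcess P Φ Λ)
    (s : SimpleFunc E ℝ≥0∞) (hs : ∀ x ≠ 0, Λ (s ⁻¹' {x}) ≠ ∞) :
    ∫⁻ ω, expNeg (∫⁻ x, s x ∂Φ ω) ∂P = expNeg (∫⁻ x, (1 - expNeg (s x)) ∂Λ) := by
  classical
  set t : Finset ℝ≥0∞ := s.range.filter (· ≠ 0) with ht
  have hint : ∀ (μ : Measure E) (g : ℝ≥0∞ → ℝ≥0∞), g 0 = 0 →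
      ∫⁻ x, g (s x) ∂μ = ∑ i : Fin t.card, g (t.equivFin.symm i) *
        μ (s ⁻¹' {(t.equivFin.symm i : ℝ≥0∞)}) := by
    intro μ g hg
    have h1 := (s.map g).lintegral_eq_lintegral μ
    rw [SimpleFunc.map_lintegral] at h1
    simp only [SimpleFunc.coe_map, Function.comp_apply] at h1
    rw [h1, Equiv.sum_comp t.equivFin.symm (fun x : t => g x * μ (s ⁻¹' {(x : ℝ≥0∞)})),
      Finset.sum_coe_sort t (fun x => g x * μ (s ⁻¹' {x})), ht, Finset.sum_filter]
    refine Finset.sum_congr rfl fun x _ => ?_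
    split_ifs with hx
    · rfl
    · rw [not_not.1 hx, hg, zero_mul]
  have hne : ∀ i, (t.equivFin.symm i : ℝ≥0∞) ≠ 0 := fun i =>
    (Finset.mem_filter.1 (t.equivFin.symm i).2).2
  have hmeas : ∀ i, MeasurableSet (s ⁻¹' {(t.equivFin.symm i : ℝ≥0∞)}) := fun i =>
    s.measurableSet_preimage _
  have hind := h.indep t.card (fun i => s ⁻¹' {(t.equivFin.symm i : ℝ≥0∞)}) hmeas (by
    intro i j hij
    refine Disjoint.preimage _ (Set.disjoint_singleton.2 fun h' => hij ?_)
    exact t.equivFin.symm.injective (Subtype.ext h'))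
  have hind' := hind.comp (fun i y => expNeg ((t.equivFin.symm i : ℝ≥0∞) * y))
    (fun i => by fun_prop)
  have e1 : ∀ ω, expNeg (∫⁻ x, s x ∂Φ ω) = ∏ i : Fin t.card,
      expNeg ((t.equivFin.symm i : ℝ≥0∞) * Φ ω (s ⁻¹' {(t.equivFin.symm i : ℝ≥0∞)})) := by
    intro ω
    rw [← expNeg_sum, hint (Φ ω) (fun x => x) rfl]
  simp_rw [e1]
  rw [hint Λ (fun x => 1 - expNeg x) (by simp), expNeg_sum]
  have := lintegral_prod_eq_prod_lintegral_of_indepFun Finset.univ _ hind' (fun i =>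
    (measurable_expNeg.comp (measurable_const.mul measurable_id)).comp
      (h.measurable_apply (hmeas i)))
  simp only [Function.comp_apply] at this
  rw [this]
  exact Finset.prod_congr rfl fun i _ => h.lintegral_expNeg_mul (hmeas i) (hs _ (hne i)) _

/-- The Laplace functional of a Poisson point process. -/
theorem IsPoissonProcess.lintegral_expNeg_lintegral [SigmaFinite Λ] (h : IsPoissonProcess P Φ Λ)
    {f : E → ℝ≥0∞} (hf : Measurable f) :
    ∫⁻ ω, expNeg (∫⁻ x, f x ∂Φ ω) ∂P = expNeg (∫⁻ x, (1 - expNeg (f x)) ∂Λ) := by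
  -- Cutting the approximations off outside sets of finite intensity gives every nonzero level
  -- finite intensity, while the sequence still increases to `f`.
  set s : ℕ → SimpleFunc E ℝ≥0∞ := fun n =>
    (SimpleFunc.eapprox f n).restrict (spanningSets Λ n) with hs
  have hsval : ∀ n x, s n x = (spanningSets Λ n).indicator (SimpleFunc.eapprox f n) x :=
    fun n x => by rw [hs, SimpleFunc.restrict_apply _ (measurableSet_spanningSets Λ n)]
  have hfin : ∀ n, ∀ x ≠ 0, Λ (s n ⁻¹' {x}) ≠ ∞ := by
    intro n x hx
    refine ne_top_of_le_ne_top (measure_spanningSets_lt_top Λ n).ne (measure_mono ?_)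
    intro y hy
    by_contra hy'
    have : s n y = x := hy
    rw [hsval, Set.indicator_of_notMem hy'] at this
    exact hx this.symm
  have hmono : ∀ x, Monotone fun n => s n x := by
    intro x m n hmn
    simp only [hsval]
    by_cases hx : x ∈ spanningSets Λ m
    · rw [Set.indicator_of_mem hx, Set.indicator_of_mem (monotone_spanningSets Λ hmn hx)]
      exact SimpleFunc.monotone_eapprox f hmn x
    · rw [Set.indicator_of_notMem hx]; exact zero_le
  have hlim : ∀ x, Filter.Tendsto (fun n => s n x) Filter.atTop (𝓝 (f x)) := by
    intro x
    refine (SimpleFunc.tendsto_eapprox hf x).congr' ?_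
    filter_upwards [Filter.eventually_ge_atTop (spanningSetsIndex Λ x)] with n hn
    rw [hsval, Set.indicator_of_mem (mem_spanningSets_of_index_le Λ x hn)]
  have hΦ : ∀ ω, Filter.Tendsto (fun n => expNeg (∫⁻ x, s n x ∂Φ ω)) Filter.atTop
      (𝓝 (expNeg (∫⁻ x, f x ∂Φ ω))) := fun ω =>
    (continuous_expNeg.tendsto _).comp (lintegral_tendsto_of_tendsto_of_monotone
      (fun n => (s n).measurable.aemeasurable) (ae_of_all _ hmono) (ae_of_all _ hlim))
  have hmeas : ∀ {g : E → ℝ≥0∞}, Measurable g →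
      Measurable fun ω => expNeg (∫⁻ x, g x ∂Φ ω) := fun hg =>
    measurable_expNeg.comp ((Measure.measurable_lintegral hg).comp h.measurable)
  have L1 : Filter.Tendsto (fun n => ∫⁻ ω, expNeg (∫⁻ x, s n x ∂Φ ω) ∂P) Filter.atTop
      (𝓝 (∫⁻ ω, expNeg (∫⁻ x, f x ∂Φ ω) ∂P)) :=
    tendsto_lintegral_of_dominated_convergence (fun _ => 1)
      (fun n => hmeas (s n).measurable) (fun n => ae_of_all _ fun ω => expNeg_le_one _)
      (by simp) (ae_of_all _ hΦ)
  -- Λ may be infinite, so the constant bound used under `P` is of no help here; monotone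
  -- convergence applies because `1 - expNeg` is increasing.
  have L2 : Filter.Tendsto (fun n => expNeg (∫⁻ x, (1 - expNeg (s n x)) ∂Λ)) Filter.atTop
      (𝓝 (expNeg (∫⁻ x, (1 - expNeg (f x)) ∂Λ))) := by
    refine (continuous_expNeg.tendsto _).comp (lintegral_tendsto_of_tendsto_of_monotone
      (fun n => ?_) (ae_of_all _ fun x m n hmn => ?_) (ae_of_all _ fun x => ?_))
    · exact (measurable_const.sub (measurable_expNeg.comp (s n).measurable)).aemeasurable
    · exact tsub_le_tsub_left (expNeg_antitone (hmono x hmn)) _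
    · exact ENNReal.Tendsto.sub tendsto_const_nhds ((continuous_expNeg.tendsto _).comp (hlim x))
        (Or.inl ENNReal.one_ne_top)
  simp_rw [fun n => h.lintegral_expNeg_simpleFunc (s n) (hfin n)] at L1
  exact tendsto_nhds_unique L1 L2

end Laplace

/-! ### An integral representation of the hypergeometric function -/

section Hypergeometric

/-- Both sides are the rising factorial of length `n + 1`. Since (α-2)/α = -2/α + 1, this collapses
the ratio of Pochhammer symbols in the series. -/
theorem ascPochhammer_eval_add_one (x : ℝ) (n : ℕ) :
    x * (ascPochhammer ℝ n).eval (x + 1) = (ascPochhammer ℝ n).eval x * (x + n) := by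
  rw [← ascPochhammer_succ_eval, ascPochhammer_succ_left]
  simp

theorem ascPochhammer_eval_natCast_succ (k n : ℕ) :
    (ascPochhammer ℝ n).eval ((k + 1 : ℕ) : ℝ) = n.factorial * (n + k).choose k := by
  rw [← ascPochhammer_eval_cast, ascPochhammer_nat_eq_ascFactorial,
    Nat.ascFactorial_eq_factorial_mul_choose, add_comm k n, Nat.choose_symm_add]
  push_cast; ring

theorem ascPochhammer_eval_ne_zero {x : ℝ} (hx : -1 < x) (hx0 : x ≠ 0) (n : ℕ) :
    (ascPochhammer ℝ n).eval x ≠ 0 := by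
  induction n with
  | zero => simp
  | succ n ih =>
    rw [ascPochhammer_succ_eval]
    refine mul_ne_zero ih ?_
    rcases n with _ | n
    · simpa using hx0
    · have : (0 : ℝ) ≤ n := n.cast_nonneg
      push_cast; linarith

variable {α : ℝ}

/-- With a = -2/α and c = a + 1, the ratio (a)_n / (c)_n is a/(a+n) = 2/(2 - αn). The comparison is
term by term, so convergence plays no role. -/
theorem ordinaryHypergeometric_neg_two_div (hα : 2 < α) (k : ℕ) (z : ℝ) :
    (ordinaryHypergeometric (-2 / α) ((k + 1 : ℕ) : ℝ) ((α - 2) / α) z : ℝ) =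
      ∑' n : ℕ, ((n + k).choose k * (2 / (2 - α * n))) * z ^ n := by
  have hα0 : α ≠ 0 := by linarith
  rw [ordinaryHypergeometric_eq_tsum]
  refine tsum_congr fun n => ?_
  rw [smul_eq_mul, ascPochhammer_eval_natCast_succ]
  have hx : (α - 2) / α = -2 / α + 1 := by field_simp; ring
  have hx1 : -1 < -2 / α := by rw [lt_div_iff₀ (by linarith)]; linarith
  have hx0 : -2 / α ≠ 0 := by simp [hα0]
  have h1 := ascPochhammer_eval_add_one (-2 / α) n
  rw [← hx] at h1
  have h2 := ascPochhammer_eval_ne_zero hx1 hx0 n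
  have h4 : -1 < (α - 2) / α := by rw [hx]; linarith
  have h3 : (ascPochhammer ℝ n).eval ((α - 2) / α) ≠ 0 :=
    ascPochhammer_eval_ne_zero h4 (div_ne_zero (by linarith) hα0) n
  have hd : -2 / α + n ≠ 0 := by
    intro h0
    rw [h0, mul_zero] at h1
    exact mul_ne_zero hx0 h3 h1
  have hd' : 2 - α * n ≠ 0 := by
    intro h0
    apply hd
    field_simp
    linarith
  have h5 : (ascPochhammer ℝ n).eval (-2 / α) * ((ascPochhammer ℝ n).eval ((α - 2) / α))⁻¹ =
      2 / (2 - α * n) := by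
    rw [← div_eq_mul_inv, div_eq_div_iff h3 hd']
    have hxα : α * (-2 / α) = -2 := by field_simp
    linear_combination α * h1 + ((ascPochhammer ℝ n).eval (-2 / α) -
      (ascPochhammer ℝ n).eval ((α - 2) / α)) * hxα
  have hf : (n.factorial : ℝ) ≠ 0 := by exact_mod_cast n.factorial_ne_zero
  rw [← h5]
  field_simp

theorem integrableOn_Ioi_mul_rpow_neg (hα : 2 < α) :
    IntegrableOn (fun v : ℝ => v * v ^ (-α)) (Ioi 1) := by
  refine (integrableOn_Ioi_rpow_of_lt (a := 1 - α) (by linarith) one_pos).congr_fun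
    (fun v hv => ?_) measurableSet_Ioi
  have hv : 0 < v := one_pos.trans hv
  simp only [sub_eq_add_neg, Real.rpow_add hv, Real.rpow_one]

theorem rpow_neg_mem_Icc (hα : 2 < α) {v : ℝ} (hv : 1 < v) : v ^ (-α) ∈ Icc (0 : ℝ) 1 :=
  ⟨by positivity, Real.rpow_le_one_of_one_le_of_nonpos hv.le (by linarith)⟩

/-- The point 1 - zt lies on the segment from 1 to 1 - z, whose endpoints both have real part at
least δ. -/
theorem norm_inv_one_sub_mul_le {z : ℂ} {δ t : ℝ} (hδ : 0 < δ) (hδ1 : δ ≤ 1)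
    (hz : z.re ≤ 1 - δ) (ht : t ∈ Icc (0 : ℝ) 1) : ‖(1 - z * (t : ℂ))⁻¹‖ ≤ δ⁻¹ := by
  rw [norm_inv]
  refine inv_anti₀ hδ ?_
  have h1 : (1 - z * (t : ℂ)).re = 1 - z.re * t := by simp
  have h2 : δ ≤ (1 - z * (t : ℂ)).re := by
    rw [h1]
    nlinarith [ht.1, ht.2, mul_nonneg ht.1 (sub_nonneg.2 hz)]
  exact h2.trans ((le_abs_self _).trans (Complex.abs_re_le_norm _))

/-- With w = 1/(1 - zt), factor 1 - w^k = (1 - w) ∑ w^i and use 1 - w = -ztw. The factor `t`, later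
v^{-α}, gives the decay that makes the integrand integrable at infinity. -/
theorem norm_one_sub_inv_pow_le (k : ℕ) {z : ℂ} {δ t : ℝ} (hδ : 0 < δ) (hδ1 : δ ≤ 1)
    (hz : z.re ≤ 1 - δ) (ht : t ∈ Icc (0 : ℝ) 1) :
    ‖1 - ((1 - z * (t : ℂ))⁻¹) ^ k‖ ≤ ‖z‖ * δ⁻¹ * (∑ i ∈ Finset.range k, δ⁻¹ ^ i) * t := by
  have hw := norm_inv_one_sub_mul_le hδ hδ1 hz ht
  have hne : 1 - z * (t : ℂ) ≠ 0 := by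
    intro h0
    have h1 : (1 - z * (t : ℂ)).re = 1 - z.re * t := by simp
    rw [h0, Complex.zero_re] at h1
    nlinarith [ht.1, ht.2, mul_nonneg ht.1 (sub_nonneg.2 hz)]
  set w := (1 - z * (t : ℂ))⁻¹ with hwdef
  have h1 : 1 - w = -(z * t * w) := by
    have : (1 - z * (t : ℂ)) * w = 1 := mul_inv_cancel₀ hne
    linear_combination -this
  rw [← mul_neg_geom_sum, norm_mul, h1, norm_neg, norm_mul, norm_mul, Complex.norm_real,
    Real.norm_of_nonneg ht.1]
  have h2 : ‖∑ i ∈ Finset.range k, w ^ i‖ ≤ ∑ i ∈ Finset.range k, δ⁻¹ ^ i := by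
    refine (norm_sum_le _ _).trans (Finset.sum_le_sum fun i _ => ?_)
    rw [norm_pow]
    exact pow_le_pow_left₀ (norm_nonneg _) hw i
  calc ‖z‖ * t * ‖w‖ * ‖∑ i ∈ Finset.range k, w ^ i‖
      ≤ ‖z‖ * t * δ⁻¹ * ∑ i ∈ Finset.range k, δ⁻¹ ^ i := by
        have := ht.1
        gcongr
    _ = _ := by ring

theorem measurable_cpow_integrand (k : ℕ) (z : ℂ) :
    Measurable fun v : ℝ => (v : ℂ) * (1 - ((1 - z * ((v ^ (-α) : ℝ) : ℂ))⁻¹) ^ k) := by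
  have : Measurable fun v : ℝ => ((v ^ (-α) : ℝ) : ℂ) :=
    Complex.measurable_ofReal.comp (measurable_id.pow_const _)
  fun_prop

theorem integrableOn_cpow_integrand (hα : 2 < α) (k : ℕ) {z : ℂ} (hz : z.re < 1) :
    IntegrableOn (fun v : ℝ => (v : ℂ) * (1 - ((1 - z * ((v ^ (-α) : ℝ) : ℂ))⁻¹) ^ k))
      (Ioi 1) := by
  obtain ⟨δ, hδ, hδ1, hzδ⟩ : ∃ δ : ℝ, 0 < δ ∧ δ ≤ 1 ∧ z.re ≤ 1 - δ :=
    ⟨min 1 (1 - z.re), lt_min one_pos (by linarith), min_le_left _ _,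
      by linarith [min_le_right 1 (1 - z.re)]⟩
  refine Integrable.mono' ((integrableOn_Ioi_mul_rpow_neg hα).const_mul
    (‖z‖ * δ⁻¹ * (∑ i ∈ Finset.range k, δ⁻¹ ^ i)))
    (measurable_cpow_integrand k z).aestronglyMeasurable ?_
  filter_upwards [ae_restrict_mem measurableSet_Ioi] with v hv
  have hv0 : 0 < v := one_pos.trans hv
  rw [norm_mul, Complex.norm_real, Real.norm_of_nonneg hv0.le]
  have := norm_one_sub_inv_pow_le k hδ hδ1 hzδ (rpow_neg_mem_Icc hα hv)
  calc v * _ ≤ v * _ := mul_le_mul_of_nonneg_left this hv0.le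
    _ = _ := by ring

/-- Differentiation under the integral sign. The parameter is complex because holomorphy on an open
half-plane yields analyticity, which is what uniqueness of the continuation requires. -/
theorem differentiableOn_integral_cpow (hα : 2 < α) (k : ℕ) :
    DifferentiableOn ℂ (fun z : ℂ => ∫ v in Ioi (1 : ℝ),
      (v : ℂ) * (1 - ((1 - z * ((v ^ (-α) : ℝ) : ℂ))⁻¹) ^ k)) {z | z.re < 1} := by
  intro z hz
  have hz : z.re < 1 := hz
  -- Halving the gap keeps `z` strictly inside Re w < 1 - δ, a neighbourhood on which one bound for
  -- the derivative serves all `w`.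
  obtain ⟨δ, hδ, hδ1, hzδ⟩ : ∃ δ : ℝ, 0 < δ ∧ δ ≤ 1 ∧ z.re < 1 - δ :=
    ⟨min 1 ((1 - z.re) / 2), lt_min one_pos (by linarith), min_le_left _ _,
      by linarith [min_le_right 1 ((1 - z.re) / 2)]⟩
  have hs : {w : ℂ | w.re < 1 - δ} ∈ 𝓝 z :=
    (isOpen_lt Complex.continuous_re continuous_const).mem_nhds hzδ
  refine (hasDerivAt_integral_of_dominated_loc_of_deriv_le
    (F' := fun w v => (v : ℂ) * -(k * ((1 - w * ((v ^ (-α) : ℝ) : ℂ))⁻¹) ^ (k - 1) *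
      (((v ^ (-α) : ℝ) : ℂ) * ((1 - w * ((v ^ (-α) : ℝ) : ℂ))⁻¹) ^ 2)))
    (bound := fun v => k * δ⁻¹ ^ (k - 1) * δ⁻¹ ^ 2 * (v * v ^ (-α)))
    hs (Filter.Eventually.of_forall fun w =>
      (measurable_cpow_integrand k w).aestronglyMeasurable)
    (integrableOn_cpow_integrand hα k hz) ?_ ?_
    ((integrableOn_Ioi_mul_rpow_neg hα).const_mul _) ?_).2.differentiableAt.differentiableWithinAt
  · have : Measurable fun v : ℝ => ((v ^ (-α) : ℝ) : ℂ) :=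
      Complex.measurable_ofReal.comp (measurable_id.pow_const _)
    exact Measurable.aestronglyMeasurable (by fun_prop)
  · filter_upwards [ae_restrict_mem measurableSet_Ioi] with v hv w hw
    have hv0 : 0 < v := one_pos.trans hv
    have ht := rpow_neg_mem_Icc hα hv
    have := norm_inv_one_sub_mul_le hδ hδ1 (le_of_lt hw) ht
    rw [norm_mul, norm_neg, norm_mul, norm_mul, norm_mul, norm_pow, norm_pow, Complex.norm_real,
      Complex.norm_real, Real.norm_of_nonneg hv0.le, Real.norm_of_nonneg ht.1,
      Complex.norm_natCast]
    have ht1 := ht.1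
    calc v * (k * ‖(1 - w * ((v ^ (-α) : ℝ) : ℂ))⁻¹‖ ^ (k - 1) *
          (v ^ (-α) * ‖(1 - w * ((v ^ (-α) : ℝ) : ℂ))⁻¹‖ ^ 2))
        ≤ v * (k * δ⁻¹ ^ (k - 1) * (v ^ (-α) * δ⁻¹ ^ 2)) := by gcongr
      _ = _ := by ring
  · filter_upwards [ae_restrict_mem measurableSet_Ioi] with v hv w hw
    have ht := rpow_neg_mem_Icc hα hv
    have hw : w.re < 1 - δ := hw
    have hne : 1 - w * ((v ^ (-α) : ℝ) : ℂ) ≠ 0 := by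
      intro h0
      have h1 : (1 - w * ((v ^ (-α) : ℝ) : ℂ)).re = 1 - w.re * v ^ (-α) := by simp
      rw [h0, Complex.zero_re] at h1
      nlinarith [ht.1, ht.2, mul_nonneg ht.1 (sub_nonneg.2 hw.le)]
    have h1 : HasDerivAt (fun w : ℂ => 1 - w * ((v ^ (-α) : ℝ) : ℂ))
        (-((v ^ (-α) : ℝ) : ℂ)) w := by
      simpa using ((hasDerivAt_id w).mul_const ((v ^ (-α) : ℝ) : ℂ)).const_sub 1
    have h2 := ((h1.fun_inv hne).fun_pow k).const_sub 1 |>.const_mul (v : ℂ)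
    refine h2.congr_deriv ?_
    field_simp

theorem integral_cpow_ofReal (k : ℕ) (z : ℝ) :
    (∫ v in Ioi (1 : ℝ), (v : ℂ) * (1 - ((1 - (z : ℂ) * ((v ^ (-α) : ℝ) : ℂ))⁻¹) ^ k)) =
      ((∫ v in Ioi (1 : ℝ), v * (1 - ((1 - z * v ^ (-α))⁻¹) ^ k) : ℝ) : ℂ) := by
  refine Eq.trans (integral_congr_ae (ae_of_all _ fun v => ?_)) integral_complex_ofReal
  push_cast
  rfl

theorem integrableOn_rpow_integrand (hα : 2 < α) (k : ℕ) {z : ℝ} (hz : z < 1) :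
    IntegrableOn (fun v : ℝ => v * (1 - ((1 - z * v ^ (-α))⁻¹) ^ k)) (Ioi 1) := by
  have h := (integrableOn_cpow_integrand hα k (z := z) (by simpa using hz)).re
  refine h.congr (ae_of_all _ fun v => ?_)
  have h1 : (v : ℂ) * (1 - ((1 - (z : ℂ) * ((v ^ (-α) : ℝ) : ℂ))⁻¹) ^ k) =
      ((v * (1 - ((1 - z * v ^ (-α))⁻¹) ^ k) : ℝ) : ℂ) := by
    push_cast
    rfl
  beta_reduce
  rw [h1]
  exact Complex.ofReal_re _

theorem analyticAt_integral_rpow (hα : 2 < α) (k : ℕ) {z : ℝ} (hz : z < 1) :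
    AnalyticAt ℝ (fun z : ℝ => 1 + 2 * ∫ v in Ioi (1 : ℝ),
      v * (1 - ((1 - z * v ^ (-α))⁻¹) ^ k)) z := by
  have ho : IsOpen {z : ℂ | z.re < 1} := isOpen_lt Complex.continuous_re continuous_const
  have h := ((differentiableOn_integral_cpow hα k).analyticOnNhd ho (z : ℂ)
    (by simpa using hz)).re_ofReal
  simp only [integral_cpow_ofReal, Complex.ofReal_re] at h
  exact analyticAt_const.add (analyticAt_const.mul h)

theorem integral_Ioi_mul_rpow_neg_pow (hα : 2 < α) (n : ℕ) :
    IntegrableOn (fun v : ℝ => v * (v ^ (-α)) ^ (n + 1)) (Ioi 1) ∧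
    ∫ v in Ioi (1 : ℝ), v * (v ^ (-α)) ^ (n + 1) = 1 / (α * (n + 1) - 2) := by
  have hn : (0 : ℝ) ≤ n := n.cast_nonneg
  have ha : 1 - α * (n + 1) < -1 := by nlinarith
  have he : ∀ v ∈ Ioi (1 : ℝ), v ^ (1 - α * (n + 1)) = v * (v ^ (-α)) ^ (n + 1) := by
    intro v hv
    have hv : 0 < v := one_pos.trans hv
    rw [← Real.rpow_natCast, ← Real.rpow_mul hv.le, sub_eq_add_neg, Real.rpow_add hv,
      Real.rpow_one]
    push_cast
    rw [neg_mul]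
  refine ⟨(integrableOn_Ioi_rpow_of_lt ha one_pos).congr_fun he measurableSet_Ioi, ?_⟩
  rw [← setIntegral_congr_fun measurableSet_Ioi he, integral_Ioi_rpow_of_lt ha one_pos,
    Real.one_rpow]
  rw [neg_div, ← div_neg]
  congr 1
  ring

/-- Expand (1 - x)^{-(k+1)} = ∑ C(n+k, k) x^n at x = z v^{-α} and integrate term by term. The term
`n = 0`, whose integral would diverge, cancels against the 1 in the integrand, so the terms are
indexed from `n + 1`; the `1 +` outside is the term `n = 0` of the target series. -/
theorem one_add_integral_eq_tsum (hα : 2 < α) (k : ℕ) {z : ℝ} (hz : |z| < 1) :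
    1 + 2 * ∫ v in Ioi (1 : ℝ), v * (1 - ((1 - z * v ^ (-α))⁻¹) ^ (k + 1)) =
      ∑' n : ℕ, ((n + k).choose k * (2 / (2 - α * n))) * z ^ n := by
  have hden : ∀ n : ℕ, α - 2 ≤ α * (n + 1) - 2 := fun n => by
    have hn : (0 : ℝ) ≤ n := n.cast_nonneg
    nlinarith
  set c : ℕ → ℝ := fun n => (n + 1 + k).choose k * z ^ (n + 1) with hc
  set f : ℕ → ℝ → ℝ := fun n v => -c n * (v * (v ^ (-α)) ^ (n + 1)) with hf
  have hgeom := summable_choose_mul_geometric_of_norm_lt_one k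
    (r := |z|) (by simpa using hz)
  have hsum : Summable fun n => |c n| := by
    refine ((summable_nat_add_iff 1).2 hgeom).congr fun n => ?_
    rw [hc, abs_mul, abs_pow, Nat.abs_cast]
  have hint : ∀ n, Integrable (f n) (volume.restrict (Ioi 1)) := fun n =>
    (integral_Ioi_mul_rpow_neg_pow hα n).1.const_mul _
  have hnorm : ∀ n, ∫ v in Ioi (1 : ℝ), ‖f n v‖ = |c n| * (1 / (α * (n + 1) - 2)) := by
    intro n
    rw [← (integral_Ioi_mul_rpow_neg_pow hα n).2, ← integral_const_mul]
    refine setIntegral_congr_fun measurableSet_Ioi fun v hv => ?_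
    have hv : 0 < v := one_pos.trans hv
    simp only [hf, norm_mul, norm_neg, Real.norm_eq_abs]
    rw [abs_of_pos hv, abs_of_nonneg (by positivity : 0 ≤ (v ^ (-α)) ^ (n + 1))]
  have hs := hasSum_integral_of_summable_integral_norm hint (by
    simp_rw [hnorm]
    refine Summable.of_nonneg_of_le (fun n => ?_) (fun n => ?_)
      (hsum.mul_right (1 / (α - 2)))
    · have := hden n
      have : 0 < α * (n + 1) - 2 := by linarith
      positivity
    · have := hden n
      have h2 : 0 < α - 2 := by linarith
      gcongr)
  have hval : ∫ v in Ioi (1 : ℝ), ∑' n, f n v =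
      ∫ v in Ioi (1 : ℝ), v * (1 - ((1 - z * v ^ (-α))⁻¹) ^ (k + 1)) := by
    refine setIntegral_congr_fun measurableSet_Ioi fun v hv => ?_
    have ht := rpow_neg_mem_Icc hα hv
    have hr : ‖z * v ^ (-α)‖ < 1 := by
      rw [norm_mul, Real.norm_eq_abs, Real.norm_of_nonneg ht.1]
      nlinarith [abs_nonneg z, ht.1, ht.2]
    have h1 := hasSum_choose_mul_geometric_of_norm_lt_one k hr
    have h2 := ((hasSum_nat_add_iff' 1).2 h1).mul_left (-v)
    simp only [Finset.range_one, Finset.sum_singleton, zero_add, Nat.choose_self, pow_zero,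
      Nat.cast_one, mul_one] at h2
    have h3 : ∀ n, f n v = -v * (((n + 1 + k).choose k : ℝ) * (z * v ^ (-α)) ^ (n + 1)) := by
      intro n
      simp only [hf, hc, mul_pow]
      ring
    simp only [h3]
    rw [h2.tsum_eq, one_div, inv_pow]
    ring
  have hfi : ∀ n, ∫ v in Ioi (1 : ℝ), f n v = -c n * (1 / (α * (n + 1) - 2)) := fun n => by
    rw [← (integral_Ioi_mul_rpow_neg_pow hα n).2, ← integral_const_mul]
  simp_rw [hfi] at hs
  rw [hval] at hs
  have hs2 := hs.mul_left 2
  have h4 : ∀ n : ℕ, 2 * (-c n * (1 / (α * (n + 1) - 2))) =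
      ((n + 1 + k).choose k * (2 / (2 - α * ((n + 1 : ℕ) : ℝ)))) * z ^ (n + 1) := by
    intro n
    have h5 : α * (n + 1) - 2 ≠ 0 := by have := hden n; linarith
    have h6 : 2 - α * ((n + 1 : ℕ) : ℝ) = -(α * (n + 1) - 2) := by push_cast; ring
    rw [h6, div_neg]
    simp only [hc]
    ring
  simp_rw [h4] at hs2
  have h7 := ((hasSum_nat_add_iff (f := fun n : ℕ =>
    (((n + k).choose k : ℝ) * (2 / (2 - α * n))) * z ^ n) 1).1 hs2).tsum_eq
  rw [h7]
  simp [add_comm]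

/-- An integral representation of `₂F₁(-2/α, k; (α-2)/α; z)` for `z < 1`. -/
theorem gaussHyp_neg_two_div (hα : 2 < α) {k : ℕ} (hk : k ≠ 0) {z : ℝ} (hz : z < 1) :
    gaussHyp (-2 / α) k ((α - 2) / α) z =
      1 + 2 * ∫ v in Ioi (1 : ℝ), v * (1 - ((1 - z * v ^ (-α))⁻¹) ^ k) := by
  obtain ⟨k, rfl⟩ := Nat.exists_eq_succ_of_ne_zero hk
  -- The integral is analytic at every real point below 1, hence along the segment from 0 to `z`,
  -- and agrees with the series on the unit ball.
  refine gaussHyp_eq (F := fun z : ℝ => 1 + 2 * ∫ v in Ioi (1 : ℝ),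
      v * (1 - ((1 - z * v ^ (-α))⁻¹) ^ (k + 1))) (fun w hw => ?_) ?_
  · refine analyticAt_integral_rpow hα (k + 1) ?_
    exact (Set.mem_uIcc.1 hw).elim (fun h => h.2.trans_lt hz) (fun h => h.2.trans_lt one_pos)
  · filter_upwards [Metric.ball_mem_nhds (0 : ℝ) one_pos] with w hw
    have hw : |w| < 1 := by simpa using hw
    rw [one_add_integral_eq_tsum hα k hw, ← ordinaryHypergeometric_neg_two_div hα]

end Hypergeometric

/-! ### Exponential random variables -/

section Exponential

instance isProbabilityMeasure_expMeasure_one : IsProbabilityMeasure (expMeasure 1) :=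
  isProbabilityMeasure_expMeasure one_pos

theorem lintegral_Ioi_exp_neg_mul {b : ℝ} (hb : 0 < b) (a : ℝ) :
    ∫⁻ x in Ioi a, ENNReal.ofReal (Real.exp (-b * x)) =
      ENNReal.ofReal (Real.exp (-b * a) / b) := by
  have hb' : -b < 0 := by linarith
  rw [← ofReal_integral_eq_lintegral_ofReal (integrableOn_exp_mul_Ioi hb' a)
    (ae_of_all _ fun x => Real.exp_nonneg _), integral_exp_mul_Ioi hb' a, neg_div_neg_eq]

theorem lintegral_expMeasure_one {f : ℝ → ℝ≥0∞} (hf : Measurable f) :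
    ∫⁻ x, f x ∂expMeasure 1 = ∫⁻ x in Ioi 0, ENNReal.ofReal (Real.exp (-x)) * f x := by
  have hm : Measurable (gammaPDF 1 1) := (measurable_gammaPDFReal 1 1).ennreal_ofReal
  rw [expMeasure, gammaMeasure, lintegral_withDensity_eq_lintegral_mul _ hm hf,
    ← lintegral_indicator measurableSet_Ioi]
  have h0 : ∀ᵐ x : ℝ, x ≠ 0 := by simp [ae_iff]
  refine lintegral_congr_ae ?_
  filter_upwards [h0] with x hx
  rcases lt_or_gt_of_ne hx with h | h
  · rw [Pi.mul_apply, gammaPDF_of_neg h, zero_mul, Set.indicator_of_notMem (by simp [h.le])]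
  · rw [Pi.mul_apply, gammaPDF_of_nonneg h.le, Set.indicator_of_mem (by simpa using h)]
    simp

theorem ae_pos_expMeasure_one : ∀ᵐ x ∂expMeasure 1, 0 < x := by
  have h := lintegral_expMeasure_one
    (f := (Ioi (0 : ℝ))ᶜ.indicator 1) (measurable_one.indicator measurableSet_Ioi.compl)
  rw [lintegral_indicator_one measurableSet_Ioi.compl] at h
  rw [ae_iff]
  refine Eq.trans h ?_
  rw [← lintegral_zero (μ := volume.restrict (Ioi (0 : ℝ)))]
  refine setLIntegral_congr_fun measurableSet_Ioi fun x hx => ?_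
  rw [Set.indicator_of_notMem (by simpa using hx), mul_zero]

/-- The tail of the exponential law. -/
theorem expMeasure_one_tail (y : ℝ≥0∞) : expMeasure 1 {x | y ≤ ENNReal.ofReal x} = expNeg y := by
  rcases eq_or_ne y ∞ with rfl | hy
  · simp
  have hm : MeasurableSet {x : ℝ | y ≤ ENNReal.ofReal x} :=
    measurableSet_le measurable_const ENNReal.measurable_ofReal
  rw [← lintegral_indicator_one hm, lintegral_expMeasure_one (measurable_one.indicator hm)]
  have hset : ∫⁻ x in Ioi (0 : ℝ), ENNReal.ofReal (Real.exp (-x)) *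
      {x : ℝ | y ≤ ENNReal.ofReal x}.indicator 1 x =
      ∫⁻ x in Ici y.toReal, ENNReal.ofReal (Real.exp (-1 * x)) := by
    rw [← lintegral_indicator measurableSet_Ioi, ← lintegral_indicator measurableSet_Ici]
    have h0 : ∀ᵐ x : ℝ, x ≠ 0 := by simp [ae_iff]
    refine lintegral_congr_ae ?_
    filter_upwards [h0] with x hx
    by_cases h : x ∈ Ioi (0 : ℝ)
    · rw [Set.indicator_of_mem h]
      have hiff : x ∈ {x : ℝ | y ≤ ENNReal.ofReal x} ↔ x ∈ Ici y.toReal := by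
        rw [Set.mem_ofPred_eq, Set.mem_Ici, ENNReal.le_ofReal_iff_toReal_le hy (le_of_lt h)]
      by_cases h' : x ∈ Ici y.toReal
      · rw [Set.indicator_of_mem (hiff.2 h'), Set.indicator_of_mem h']; simp
      · rw [Set.indicator_of_notMem (mt hiff.1 h'), Set.indicator_of_notMem h', mul_zero]
    · rw [Set.indicator_of_notMem h, Set.indicator_of_notMem]
      intro h'
      have h1 : y.toReal ≤ x := h'
      have h2 : x ≤ 0 := not_lt.1 h
      exact hx (le_antisymm h2 (ENNReal.toReal_nonneg.trans h1))
  rw [hset, setLIntegral_congr Ioi_ae_eq_Ici.symm, lintegral_Ioi_exp_neg_mul one_pos, div_one,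
    neg_one_mul, ← expNeg_ofReal ENNReal.toReal_nonneg, ENNReal.ofReal_toReal hy]

/-- The Laplace transform of the exponential law. -/
theorem lintegral_expNeg_expMeasure_one {s : ℝ} (hs : 0 ≤ s) :
    ∫⁻ x, expNeg (ENNReal.ofReal (s * x)) ∂expMeasure 1 = ENNReal.ofReal (1 + s)⁻¹ := by
  rw [lintegral_expMeasure_one (by fun_prop)]
  have h : ∀ x ∈ Ioi (0 : ℝ), ENNReal.ofReal (Real.exp (-x)) * expNeg (ENNReal.ofReal (s * x)) =
      ENNReal.ofReal (Real.exp (-(1 + s) * x)) := by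
    intro x hx
    have hx : 0 < x := hx
    rw [expNeg_ofReal (by positivity), ← ENNReal.ofReal_mul (Real.exp_nonneg _), ← Real.exp_add]
    congr 2; ring
  rw [setLIntegral_congr_fun measurableSet_Ioi h, lintegral_Ioi_exp_neg_mul (by linarith)]
  simp

theorem lintegral_pi_prod_eval {ι : Type*} [Fintype ι] (μ : ι → Measure ℝ)
    [∀ i, IsProbabilityMeasure (μ i)] (T : Finset ι) {f : ι → ℝ → ℝ≥0∞}
    (hf : ∀ i, Measurable (f i)) :
    ∫⁻ x, ∏ i ∈ T, f i (x i) ∂Measure.pi μ = ∏ i ∈ T, ∫⁻ y, f i y ∂μ i := by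
  refine (lintegral_prod_eq_prod_lintegral_of_indepFun T (fun i (x : ι → ℝ) => f i (x i))
    (iIndepFun_pi fun i => (hf i).aemeasurable)
    (fun i => (hf i).comp (measurable_pi_apply i))).trans ?_
  refine Finset.prod_congr rfl fun i _ => ?_
  exact (measurePreserving_eval μ i).lintegral_comp (hf i)

end Exponential

/-! ### The distance to the nearest base station -/

section NearestDist

theorem nearestDist_nonneg (φ : Measure Plane) : 0 ≤ nearestDist φ :=
  Real.sInf_nonneg fun _ hr => hr.1.le

theorem measurable_nearestDist : Measurable nearestDist := by
  refine measurable_of_Iio fun t => ?_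
  by_cases ht : 0 < t
  swap
  · convert! MeasurableSet.empty
    refine Set.eq_empty_of_forall_notMem fun φ hφ => ht ?_
    exact (nearestDist_nonneg φ).trans_lt hφ
  -- The mass of a ball grows with its radius, so rational radii suffice. The second set is needed
  -- because `sInf ∅ = 0`: a configuration with no mass in any ball has `nearestDist` equal to 0,
  -- which is below `t`.
  have hset : nearestDist ⁻¹' Iio t =
      (⋃ q : ℚ, ⋃ _ : 0 < (q : ℝ) ∧ (q : ℝ) < t, {φ | φ (Metric.ball 0 (q : ℝ)) ≠ 0}) ∪
      ⋂ n : ℕ, {φ | φ (Metric.ball 0 (n : ℝ)) = 0} := by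
    ext φ
    simp only [Set.mem_preimage, Set.mem_Iio, Set.mem_union, Set.mem_iUnion, Set.mem_iInter,
      Set.mem_ofPred_eq, exists_prop]
    constructor
    · intro h
      rcases ({r : ℝ | 0 < r ∧ φ (Metric.ball 0 r) ≠ 0}).eq_empty_or_nonempty with he | hne
      · right
        intro n
        by_contra hn
        rcases n.eq_zero_or_pos with rfl | hn0
        · simp at hn
        · have : (n : ℝ) ∈ {r : ℝ | 0 < r ∧ φ (Metric.ball 0 r) ≠ 0} :=
            ⟨by exact_mod_cast hn0, hn⟩
          rw [he] at this
          exact this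
      · left
        obtain ⟨r, hr, hrt⟩ := exists_lt_of_csInf_lt hne h
        obtain ⟨q, hq, hqt⟩ := exists_rat_btwn hrt
        refine ⟨q, ⟨hr.1.trans hq, hqt⟩, fun h0 => hr.2 ?_⟩
        exact measure_mono_null (Metric.ball_subset_ball hq.le) h0
    · rintro (⟨q, ⟨hq0, hqt⟩, hq⟩ | h)
      · have hle : nearestDist φ ≤ q := csInf_le ⟨0, fun _ hr => hr.1.le⟩ ⟨hq0, hq⟩
        exact hle.trans_lt hqt
      · have he : {r : ℝ | 0 < r ∧ φ (Metric.ball 0 r) ≠ 0} = ∅ := by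
          refine Set.eq_empty_of_forall_notMem fun r hr => ?_
          obtain ⟨n, hn⟩ := exists_nat_ge r
          exact hr.2 (measure_mono_null (Metric.ball_subset_ball hn) (h n))
        rw [nearestDist, he, Real.sInf_empty]
        exact ht
  rw [hset]
  refine MeasurableSet.union (MeasurableSet.iUnion fun q => MeasurableSet.iUnion fun _ => ?_)
    (MeasurableSet.iInter fun n => ?_)
  · exact (Measure.measurable_coe Metric.isOpen_ball.measurableSet
      (measurableSet_singleton (0 : ℝ≥0∞))).compl
  · exact Measure.measurable_coe Metric.isOpen_ball.measurableSet
      (measurableSet_singleton (0 : ℝ≥0∞))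

/-- An open ball is the countable union of the smaller balls of rational radius, so it is null once
they all are. The hypothesis excludes the default value of the infimum of the empty set. -/
theorem le_nearestDist_iff {φ : Measure Plane} (hφ : ∃ n : ℕ, φ (Metric.ball 0 (n : ℝ)) ≠ 0)
    {r : ℝ} : r ≤ nearestDist φ ↔ φ (Metric.ball 0 r) = 0 := by
  have hbdd : BddBelow {r : ℝ | 0 < r ∧ φ (Metric.ball 0 r) ≠ 0} := ⟨0, fun _ hr => hr.1.le⟩
  constructor
  · intro h
    have hball : Metric.ball (0 : Plane) r =
        ⋃ q : ℚ, ⋃ _ : 0 < (q : ℝ) ∧ (q : ℝ) < r, Metric.ball (0 : Plane) (q : ℝ) := by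
      ext x
      simp only [Set.mem_iUnion, exists_prop, Metric.mem_ball]
      constructor
      · intro hx
        obtain ⟨q, hq1, hq2⟩ := exists_rat_btwn hx
        exact ⟨q, ⟨dist_nonneg.trans_lt hq1, hq2⟩, hq1⟩
      · rintro ⟨q, ⟨_, hq⟩, hx⟩
        exact hx.trans hq
    rw [hball]
    refine measure_iUnion_null fun q => measure_iUnion_null fun hq => ?_
    by_contra h0
    exact absurd (h.trans (csInf_le hbdd ⟨hq.1, h0⟩)) (not_le.2 hq.2)
  · intro h
    obtain ⟨n, hn⟩ := hφ
    have hn0 : 0 < (n : ℝ) := by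
      rcases n.eq_zero_or_pos with rfl | h0
      · simp at hn
      · exact_mod_cast h0
    refine le_csInf ⟨n, hn0, hn⟩ fun s hs => ?_
    by_contra hlt
    exact hs.2 (measure_mono_null (Metric.ball_subset_ball (not_le.1 hlt).le) h)

variable {Ω : Type*} [MeasurableSpace Ω] {P : Measure Ω} {Φ : Ω → Measure Plane} {lam : ℝ}

theorem IsPoissonProcess.measure_ball_eq_zero (hlam : 0 < lam)
    (h : IsPoissonProcess P Φ (ENNReal.ofReal lam • volume)) {r : ℝ} (hr : 0 ≤ r) :
    P {ω | Φ ω (Metric.ball 0 r) = 0} =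
      ENNReal.ofReal (Real.exp (-(lam * Real.pi) * r ^ 2)) := by
  have hΛ : (ENNReal.ofReal lam • (volume : Measure Plane)) (Metric.ball 0 r) =
      ENNReal.ofReal (lam * Real.pi * r ^ 2) := by
    rw [Measure.smul_apply, EuclideanSpace.volume_ball_fin_two, smul_eq_mul,
      ← ENNReal.ofReal_pow hr, ← ENNReal.ofReal_mul (by positivity),
      ← ENNReal.ofReal_mul hlam.le]
    congr 1; ring
  have h1 := h.law (Metric.ball 0 r) Metric.isOpen_ball.measurableSet
    (by rw [hΛ]; exact ENNReal.ofReal_ne_top) 0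
  rw [poissonMeasure_singleton, hΛ] at h1
  simp only [Nat.cast_zero, pow_zero, mul_one, Nat.factorial_zero, Nat.cast_one, div_one] at h1
  rw [h1]
  congr 2
  have : 0 ≤ lam * Real.pi * r ^ 2 := by positivity
  change -(ENNReal.ofReal (lam * Real.pi * r ^ 2)).toReal = _
  rw [ENNReal.toReal_ofReal this]
  ring

/-- The void probabilities of the balls of radius `n` tend to 0. -/
theorem IsPoissonProcess.ae_exists_ball_ne_zero (hlam : 0 < lam)
    (h : IsPoissonProcess P Φ (ENNReal.ofReal lam • volume)) :
    ∀ᵐ ω ∂P, ∃ n : ℕ, Φ ω (Metric.ball 0 (n : ℝ)) ≠ 0 := by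
  rw [ae_iff]
  have hle : ∀ n : ℕ, P {ω | ¬∃ n : ℕ, Φ ω (Metric.ball 0 (n : ℝ)) ≠ 0} ≤
      ENNReal.ofReal (Real.exp (-(lam * Real.pi) * (n : ℝ) ^ 2)) := by
    intro n
    rw [← h.measure_ball_eq_zero hlam n.cast_nonneg]
    refine measure_mono fun ω hω => ?_
    by_contra h0
    exact hω ⟨n, h0⟩
  have hlim : Filter.Tendsto (fun n : ℕ =>
      ENNReal.ofReal (Real.exp (-(lam * Real.pi) * (n : ℝ) ^ 2))) Filter.atTop (𝓝 0) := by
    rw [← ENNReal.ofReal_zero]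
    refine (ENNReal.continuous_ofReal.tendsto 0).comp (Real.tendsto_exp_atBot.comp ?_)
    refine Filter.Tendsto.const_mul_atTop_of_neg (by have := Real.pi_pos; nlinarith) ?_
    exact (Filter.tendsto_pow_atTop two_ne_zero).comp tendsto_natCast_atTop_atTop
  exact le_antisymm (ge_of_tendsto' hlim hle) zero_le

/-- The second moment of the distance to the nearest point of a Poisson process in the plane. -/
theorem IsPoissonProcess.lintegral_nearestDist_sq (hlam : 0 < lam)
    (h : IsPoissonProcess P Φ (ENNReal.ofReal lam • volume)) :
    ∫⁻ R, ENNReal.ofReal (R ^ 2) ∂(P.map fun ω => nearestDist (Φ ω)) =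
      ENNReal.ofReal (1 / (lam * Real.pi)) := by
  have hm : Measurable fun ω => nearestDist (Φ ω) := measurable_nearestDist.comp h.measurable
  rw [lintegral_map (by fun_prop) hm, lintegral_eq_lintegral_meas_le P
    (ae_of_all _ fun ω => sq_nonneg _) (hm.pow_const 2).aemeasurable]
  have h1 : ∀ t ∈ Ioi (0 : ℝ), P {ω | t ≤ nearestDist (Φ ω) ^ 2} =
      ENNReal.ofReal (Real.exp (-(lam * Real.pi) * t)) := by
    intro t ht
    have ht : 0 < t := ht
    have h2 := h.measure_ball_eq_zero hlam (Real.sqrt_nonneg t)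
    rw [Real.sq_sqrt ht.le] at h2
    rw [← h2]
    refine measure_congr ?_
    filter_upwards [h.ae_exists_ball_ne_zero hlam] with ω hω
    refine propext ?_
    change t ≤ nearestDist (Φ ω) ^ 2 ↔ Φ ω (Metric.ball 0 (Real.sqrt t)) = 0
    rw [← le_nearestDist_iff hω, Real.sqrt_le_left (nearestDist_nonneg _)]
  rw [setLIntegral_congr_fun measurableSet_Ioi h1,
    lintegral_Ioi_exp_neg_mul (mul_pos hlam Real.pi_pos)]
  simp

end NearestDist

/-! ### The intensity of the interference -/

section Interference

/-- Polar coordinates and the substitution r = Rv. The integrand depends on r/R only, so R² comes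
out: one factor from the radial weight, one from dr. The factor 2π is the dimension times the area
of the unit disc. -/
theorem lintegral_plane_eq {α : ℝ} (hα : 2 < α) (k : ℕ) {γ : ℝ} (hγ : 0 < γ) {R : ℝ}
    (hR : 0 ≤ R) :
    ∫⁻ u : Plane, {u : Plane | R < ‖u‖}.indicator (fun u =>
      ENNReal.ofReal (1 - ((1 + γ * (R ^ α * ‖u‖ ^ (-α)))⁻¹) ^ k)) u =
    ENNReal.ofReal (R ^ 2) * ENNReal.ofReal (2 * Real.pi *
      ∫ v in Ioi (1 : ℝ), v * (1 - ((1 + γ * v ^ (-α))⁻¹) ^ k)) := by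
  -- At R = 0 the rescaling is impossible, but the received power is 0 and both sides vanish.
  rcases hR.eq_or_lt with rfl | hR
  · rw [Real.zero_rpow (by linarith)]
    simp
  set h : ℝ → ℝ := fun v => v * (1 - ((1 + γ * v ^ (-α))⁻¹) ^ k) with hh
  have hint : IntegrableOn h (Ioi 1) := by
    have := integrableOn_rpow_integrand hα k (z := -γ) (by linarith)
    simpa only [neg_mul, sub_neg_eq_add] using this
  set f : ℝ → ℝ := (Ioi R).indicator fun r =>
    1 - ((1 + γ * (R ^ α * r ^ (-α)))⁻¹) ^ k with hf
  have hfnn : ∀ r, 0 ≤ f r := by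
    intro r
    refine Set.indicator_nonneg (fun r hr => ?_) r
    have hr : 0 < r := hR.trans hr
    have h1 : (1 : ℝ) ≤ 1 + γ * (R ^ α * r ^ (-α)) := by
      have : 0 ≤ γ * (R ^ α * r ^ (-α)) := by positivity
      linarith
    exact sub_nonneg.2 (pow_le_one₀ (by positivity) (inv_le_one_of_one_le₀ h1))
  have hfR : ∀ r ∈ Ioi (0 : ℝ), r * f r = (Ioi R).indicator (fun r => R * h (R⁻¹ * r)) r := by
    intro r hr
    have hr : 0 < r := hr
    by_cases hr' : r ∈ Ioi R
    · rw [hf, Set.indicator_of_mem hr', Set.indicator_of_mem hr', hh]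
      simp only
      rw [Real.mul_rpow (by positivity) hr.le, Real.inv_rpow hR.le, Real.rpow_neg hR.le, inv_inv]
      field_simp
    · rw [hf, Set.indicator_of_notMem hr', Set.indicator_of_notMem hr', mul_zero]
  have hdim : Module.finrank ℝ Plane = 2 := by simp
  have hsub : Ioi R ⊆ Ioi (0 : ℝ) := Set.Ioi_subset_Ioi hR.le
  have hintR : IntegrableOn (fun r => R * h (R⁻¹ * r)) (Ioi R) := by
    refine Integrable.const_mul ?_ R
    have := (integrableOn_Ioi_comp_mul_left_iff h R (inv_pos.2 hR)).2
    rw [inv_mul_cancel₀ hR.ne'] at this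
    exact this hint
  have hintf : Integrable (fun u : Plane => f ‖u‖) := by
    rw [integrable_fun_norm_addHaar volume, hdim]
    have h1 : IntegrableOn ((Ioi R).indicator fun r => R * h (R⁻¹ * r)) (Ioi 0) :=
      ((integrable_indicator_iff measurableSet_Ioi).2 hintR).integrableOn
    refine h1.congr_fun (fun r hr => ?_) measurableSet_Ioi
    rw [← hfR r hr]
    simp
  have hval : ∫ u : Plane, f ‖u‖ = R ^ 2 * (2 * Real.pi * ∫ v in Ioi (1 : ℝ), h v) := by
    rw [integral_fun_norm_addHaar volume f, hdim]
    have h1 : ∫ y in Ioi (0 : ℝ), y ^ (2 - 1) • f y = R * (R * ∫ v in Ioi (1 : ℝ), h v) := by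
      have h2 : ∀ y ∈ Ioi (0 : ℝ), y ^ (2 - 1) • f y =
          (Ioi R).indicator (fun r => R * h (R⁻¹ * r)) y := fun y hy => by
        rw [← hfR y hy]; simp
      rw [setIntegral_congr_fun measurableSet_Ioi h2, setIntegral_indicator measurableSet_Ioi,
        Set.inter_eq_right.2 hsub, integral_const_mul,
        integral_comp_mul_left_Ioi h R (inv_pos.2 hR), inv_mul_cancel₀ hR.ne', inv_inv,
        smul_eq_mul]
    have h3 : (volume : Measure Plane).real (Metric.ball 0 1) = Real.pi := by
      rw [Measure.real, EuclideanSpace.volume_ball_fin_two]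
      simp [Real.pi_nonneg]
    rw [h1, h3, smul_eq_mul, nsmul_eq_mul]
    push_cast
    ring
  rw [← ENNReal.ofReal_mul (sq_nonneg R), ← hval, ofReal_integral_eq_lintegral_ofReal hintf
    (ae_of_all _ fun u => hfnn _)]
  refine lintegral_congr fun u => ?_
  by_cases hu : R < ‖u‖
  · rw [Set.indicator_of_mem (by exact hu), hf, Set.indicator_of_mem (by exact hu)]
  · rw [Set.indicator_of_notMem (by exact hu), hf, Set.indicator_of_notMem (by exact hu),
      ENNReal.ofReal_zero]

instance sigmaFinite_interfererIntensity (K : ℕ) (lam : ℝ) (servDist : Measure ℝ)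
    [IsProbabilityMeasure servDist] : SigmaFinite (interfererIntensity K lam servDist) := by
  have : SigmaFinite (ENNReal.ofReal lam • ((volume : Measure Plane).prod
      (servDist.prod (Measure.pi fun _ : Fin K => expMeasure 1)))) :=
    -- `ENNReal.ofReal lam` is by definition the coercion of `lam.toNNReal`, so this is a finite
    -- multiple of a σ-finite measure.
    inferInstanceAs (SigmaFinite (lam.toNNReal • ((volume : Measure Plane).prod
      (servDist.prod (Measure.pi fun _ : Fin K => expMeasure 1)))))
  unfold interfererIntensity
  infer_instance

/-- The transform of the gains: `R` is the serving distance, `u` the position. -/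
theorem lintegral_gains {K : ℕ} (T : Finset (Fin K)) {s : ℝ} (hs : 0 ≤ s) :
    ∫⁻ h : Fin K → ℝ, (1 - expNeg (∑ r ∈ T, ENNReal.ofReal (s * h r)))
      ∂(Measure.pi fun _ : Fin K => expMeasure 1) =
    ENNReal.ofReal (1 - ((1 + s)⁻¹) ^ T.card) := by
  have hm : Measurable fun h : Fin K → ℝ => expNeg (∑ r ∈ T, ENNReal.ofReal (s * h r)) := by
    fun_prop
  rw [lintegral_sub hm _ (ae_of_all _ fun h => expNeg_le_one _)]
  · simp_rw [expNeg_sum]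
    rw [lintegral_pi_prod_eval _ T (f := fun _ y => expNeg (ENNReal.ofReal (s * y)))
      (fun _ => by fun_prop)]
    simp_rw [lintegral_expNeg_expMeasure_one hs]
    rw [Finset.prod_const, lintegral_one, measure_univ, ← ENNReal.ofReal_pow (by positivity),
      ENNReal.ofReal_sub _ (by positivity), ENNReal.ofReal_one]
  · refine ne_top_of_le_ne_top ENNReal.one_ne_top ((lintegral_mono fun h => expNeg_le_one _).trans ?_)
    simp

/-- The exponent of the Laplace functional of the interference in the repetitions `T`. -/
theorem lintegral_interfererIntensity {K : ℕ} {α : ℝ} (hα : 2 < α) {γ : ℝ} (hγ : 0 < γ)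
    {lam : ℝ} (hlam : 0 ≤ lam) (servDist : Measure ℝ) [IsProbabilityMeasure servDist]
    (hnn : ∀ᵐ R ∂servDist, 0 ≤ R) {lamB : ℝ} (hlamB : 0 < lamB)
    (hsq : ∫⁻ R, ENNReal.ofReal (R ^ 2) ∂servDist = ENNReal.ofReal (1 / (lamB * Real.pi)))
    {T : Finset (Fin K)} (hT : T.Nonempty) :
    ∫⁻ x : Interferer K, (1 - expNeg (∑ r ∈ T,
      ENNReal.ofReal (γ * (x.2.1 ^ α * ‖x.1‖ ^ (-α)) * x.2.2 r)))
      ∂interfererIntensity K lam servDist =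
    ENNReal.ofReal (lam / lamB * (gaussHyp (-2 / α) T.card ((α - 2) / α) (-γ) - 1)) := by
  have hS : MeasurableSet {x : Interferer K | x.2.1 < ‖x.1‖} :=
    measurableSet_lt (by fun_prop) (by fun_prop)
  have hm : Measurable fun x : Interferer K => (1 - expNeg (∑ r ∈ T,
      ENNReal.ofReal (γ * (x.2.1 ^ α * ‖x.1‖ ^ (-α)) * x.2.2 r))) := by
    have h1 : Measurable fun x : Interferer K => x.2.1 ^ α := by fun_prop
    have h2 : Measurable fun x : Interferer K => ‖x.1‖ ^ (-α) := by fun_prop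
    fun_prop
  rw [interfererIntensity, ← lintegral_indicator hS, lintegral_smul_measure,
    lintegral_prod _ (hm.indicator hS).aemeasurable]
  have hinner : ∀ u : Plane, ∫⁻ y, {x : Interferer K | x.2.1 < ‖x.1‖}.indicator
      (fun x : Interferer K => (1 - expNeg (∑ r ∈ T,
        ENNReal.ofReal (γ * (x.2.1 ^ α * ‖x.1‖ ^ (-α)) * x.2.2 r)))) (u, y)
      ∂(servDist.prod (Measure.pi fun _ : Fin K => expMeasure 1)) =
      ∫⁻ R, {u : Plane | R < ‖u‖}.indicator (fun u =>
        ENNReal.ofReal (1 - ((1 + γ * (R ^ α * ‖u‖ ^ (-α)))⁻¹) ^ T.card)) u ∂servDist := by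
    intro u
    refine (lintegral_prod _
      ((hm.indicator hS).comp measurable_prodMk_left).aemeasurable).trans ?_
    refine lintegral_congr_ae ?_
    filter_upwards [hnn] with R hR
    by_cases hu : R < ‖u‖
    · rw [Set.indicator_of_mem (by exact hu),
        ← lintegral_gains T (by positivity : 0 ≤ γ * (R ^ α * ‖u‖ ^ (-α)))]
      exact lintegral_congr fun h => Set.indicator_of_mem (by exact hu) _
    · rw [Set.indicator_of_notMem (by exact hu), ← lintegral_zero]
      exact lintegral_congr fun h => Set.indicator_of_notMem (by exact hu) _
  simp_rw [hinner]
  have hm2 : Measurable fun x : Plane × ℝ => {u : Plane | x.2 < ‖u‖}.indicator (fun u =>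
      ENNReal.ofReal (1 - ((1 + γ * (x.2 ^ α * ‖u‖ ^ (-α)))⁻¹) ^ T.card)) x.1 := by
    have h1 : Measurable fun x : Plane × ℝ => x.2 ^ α := by fun_prop
    have h2 : Measurable fun x : Plane × ℝ => ‖x.1‖ ^ (-α) := by fun_prop
    have h3 : Measurable fun x : Plane × ℝ =>
      ENNReal.ofReal (1 - ((1 + γ * (x.2 ^ α * ‖x.1‖ ^ (-α)))⁻¹) ^ T.card) := by fun_prop
    exact h3.indicator (s := {x : Plane × ℝ | x.2 < ‖x.1‖})
      (measurableSet_lt (by fun_prop) (by fun_prop))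
  -- Integrating over the position first, for fixed `R`, is what exposes the scaling in R²; the law
  -- of `R` then enters only through its second moment.
  rw [lintegral_lintegral_swap hm2.aemeasurable]
  have houter : ∫⁻ R, (∫⁻ u : Plane, {u : Plane | R < ‖u‖}.indicator (fun u =>
        ENNReal.ofReal (1 - ((1 + γ * (R ^ α * ‖u‖ ^ (-α)))⁻¹) ^ T.card)) u) ∂servDist =
      ∫⁻ R, ENNReal.ofReal (R ^ 2) * ENNReal.ofReal (2 * Real.pi *
      ∫ v in Ioi (1 : ℝ), v * (1 - ((1 + γ * v ^ (-α))⁻¹) ^ T.card)) ∂servDist := by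
    refine lintegral_congr_ae ?_
    filter_upwards [hnn] with R hR
    exact lintegral_plane_eq hα T.card hγ hR
  rw [houter, lintegral_mul_const _ (by fun_prop), hsq,
    gaussHyp_neg_two_div hα hT.card_ne_zero (by linarith), smul_eq_mul,
    ← ENNReal.ofReal_mul (by positivity), ← ENNReal.ofReal_mul hlam]
  congr 1
  simp only [neg_mul, sub_neg_eq_add]
  have := Real.pi_ne_zero
  field_simp
  ring

theorem one_le_gaussHyp {α : ℝ} (hα : 2 < α) {γ : ℝ} (hγ : 0 < γ) {k : ℕ} (hk : k ≠ 0) :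
    1 ≤ gaussHyp (-2 / α) k ((α - 2) / α) (-γ) := by
  rw [gaussHyp_neg_two_div hα hk (by linarith)]
  have h : 0 ≤ ∫ v in Ioi (1 : ℝ), v * (1 - ((1 - -γ * v ^ (-α))⁻¹) ^ k) := by
    refine setIntegral_nonneg measurableSet_Ioi fun v hv => ?_
    have hv : 0 < v := one_pos.trans hv
    have h1 : (1 : ℝ) ≤ 1 - -γ * v ^ (-α) := by
      have : 0 ≤ γ * v ^ (-α) := by positivity
      linarith
    exact mul_nonneg hv.le (sub_nonneg.2
      (pow_le_one₀ (inv_nonneg.2 (by linarith)) (inv_le_one_of_one_le₀ h1)))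
  linarith

end Interference

/-! ### The number of users in the cell -/

section NumberOfUsers

theorem cellShape_pos : 0 < cellShape := by norm_num [cellShape]

/-- Size-biasing raises the exponent of the gamma density from c - 1 to c. -/
theorem lintegral_userCellArea {f : ℝ → ℝ≥0∞} (hf : Measurable f) :
    ∫⁻ x, f x ∂userCellArea = ∫⁻ x in Ioi 0,
      ENNReal.ofReal (cellShape ^ cellShape / Real.Gamma cellShape * x ^ cellShape *
        Real.exp (-(cellShape * x))) * f x := by
  have hm : Measurable (gammaPDF cellShape cellShape) :=
    (measurable_gammaPDFReal _ _).ennreal_ofReal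
  rw [userCellArea, lintegral_withDensity_eq_lintegral_mul _ ENNReal.measurable_ofReal hf,
    gammaMeasure, lintegral_withDensity_eq_lintegral_mul _ hm (by fun_prop),
    ← lintegral_indicator measurableSet_Ioi]
  refine lintegral_congr fun x => ?_
  rcases le_or_gt x 0 with h | h
  · simp [ENNReal.ofReal_of_nonpos h, h]
  · rw [Set.indicator_of_mem (by simpa using h), Pi.mul_apply, Pi.mul_apply,
      gammaPDF_of_nonneg h.le, ← mul_assoc, ← ENNReal.ofReal_mul
        (mul_nonneg (mul_nonneg (div_nonneg (by have := cellShape_pos; positivity)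
          (Real.Gamma_pos_of_pos cellShape_pos).le) (by positivity)) (by positivity))]
    have h1 : x ^ cellShape = x ^ (cellShape - 1) * x := by
      rw [← Real.rpow_add_one h.ne', sub_add_cancel]
    rw [h1]
    congr 2
    ring

theorem lintegral_Ioi_rpow_mul_exp {s b : ℝ} (hs : 0 < s) (hb : 0 < b) :
    ∫⁻ x in Ioi (0 : ℝ), ENNReal.ofReal (x ^ (s - 1) * Real.exp (-(b * x))) =
      ENNReal.ofReal ((1 / b) ^ s * Real.Gamma s) := by
  have h := Real.integral_rpow_mul_exp_neg_mul_Ioi hs hb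
  have hpos : 0 < (1 / b) ^ s * Real.Gamma s :=
    mul_pos (by positivity) (Real.Gamma_pos_of_pos hs)
  rw [← h, ofReal_integral_eq_lintegral_ofReal]
  -- A Bochner integral that is not 0 forces integrability, since the integral of a non-integrable
  -- function is 0 by convention.
  · exact Integrable.of_integral_ne_zero (by rw [h]; exact hpos.ne')
  · filter_upwards [ae_restrict_mem measurableSet_Ioi] with x hx
    have hx : 0 < x := hx
    positivity

/-- A mixed Poisson law with the size-biased gamma law as mixing law. -/
theorem lintegral_poisson_userCellArea {a : ℝ} (ha : 0 ≤ a) (n : ℕ) :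
    ∫⁻ x, poissonMeasure (a * x).toNNReal {n} ∂userCellArea =
      ENNReal.ofReal (cellShape ^ (cellShape + 1) * Real.Gamma (n + cellShape + 1) * a ^ n /
        (Real.Gamma (cellShape + 1) * Real.Gamma (n + 1) *
          (a + cellShape) ^ (n + cellShape + 1))) := by
  have hc := cellShape_pos
  have hΓ := Real.Gamma_pos_of_pos hc
  have hac : 0 < a + cellShape := by linarith
  have hn : (0 : ℝ) ≤ n := n.cast_nonneg
  have hs : 0 < (n : ℝ) + cellShape + 1 := by linarith
  simp_rw [poissonMeasure_singleton]
  rw [lintegral_userCellArea (by fun_prop)]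
  set C : ℝ := cellShape ^ cellShape / Real.Gamma cellShape * (a ^ n / n.factorial) with hC
  have hCnn : 0 ≤ C := by positivity
  -- The Poisson weight times the density is a gamma kernel of shape n + c + 1 and rate a + c. At
  -- the end, Γ(c+1) = c Γ(c) turns c^c / Γ(c) into c^{c+1} / Γ(c+1).
  have h1 : ∀ x ∈ Ioi (0 : ℝ), ENNReal.ofReal (cellShape ^ cellShape / Real.Gamma cellShape *
      x ^ cellShape * Real.exp (-(cellShape * x))) *
      ENNReal.ofReal (Real.exp (-((a * x).toNNReal : ℝ)) * ((a * x).toNNReal : ℝ) ^ n /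
        n.factorial) =
      ENNReal.ofReal C * ENNReal.ofReal (x ^ ((n : ℝ) + cellShape + 1 - 1) *
        Real.exp (-((a + cellShape) * x))) := by
    intro x hx
    have hx : 0 < x := hx
    rw [Real.coe_toNNReal _ (by positivity), ← ENNReal.ofReal_mul (by positivity),
      ← ENNReal.ofReal_mul hCnn]
    congr 1
    rw [add_sub_cancel_right, Real.rpow_add hx, Real.rpow_natCast, mul_pow,
      show -((a + cellShape) * x) = -(cellShape * x) + -(a * x) by ring, Real.exp_add, hC]
    ring
  rw [setLIntegral_congr_fun measurableSet_Ioi h1, lintegral_const_mul _ (by fun_prop),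
    lintegral_Ioi_rpow_mul_exp hs hac, ← ENNReal.ofReal_mul hCnn]
  congr 1
  rw [hC, Real.Gamma_add_one hc.ne', Real.Gamma_nat_eq_factorial, Real.rpow_add_one hc.ne',
    one_div, Real.inv_rpow hac.le]
  have h2 : (a + cellShape) ^ ((n : ℝ) + cellShape + 1) ≠ 0 := by positivity
  have h3 : (n.factorial : ℝ) ≠ 0 := by positivity
  field_simp

theorem numberForm_nonneg (p : NetworkParams) {A : ℝ} (hA : 0 ≤ A * p.lamA / p.lamB) (n : ℕ) :
    0 ≤ numberForm p A n := by
  have hc := cellShape_pos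
  have h1 : 0 < Real.Gamma (n + cellShape + 1) := Real.Gamma_pos_of_pos (by positivity)
  have h2 : 0 < Real.Gamma (cellShape + 1) := Real.Gamma_pos_of_pos (by positivity)
  have h3 : 0 < Real.Gamma ((n : ℝ) + 1) := Real.Gamma_pos_of_pos (by positivity)
  rw [numberForm]
  positivity

end NumberOfUsers

/-! ### The active probabilities -/

section Activity

theorem NetworkParams.lamA_nonneg (p : NetworkParams) : 0 ≤ p.lamA :=
  div_nonneg (mul_nonneg p.pa_mem.1 p.lamD_pos.le) (Nat.cast_nonneg _)

/-- Consecutive sums differ by one term. This multiplicative form shows that the active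
probabilities are nonnegative, which the defining difference does not. -/
theorem activeProb_succ (q : ℕ → ℝ) {m : ℕ} (hm : 1 ≤ m) :
    activeProb q (m + 1) = activeProb q m * (1 - q m) := by
  rw [activeProb_eq q (m + 1), activeProb_eq q m]
  obtain ⟨m, rfl⟩ := Nat.exists_eq_add_of_le' hm
  simp only [Nat.add_sub_cancel]
  rw [Finset.sum_Icc_succ_top (by omega), activeProb_eq q (m + 1), Nat.add_sub_cancel]
  ring

theorem activeProb_nonneg {q : ℕ → ℝ} (hq : ∀ m, q m ≤ 1) {m : ℕ} (hm : 1 ≤ m) :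
    0 ≤ activeProb q m := by
  induction m, hm using Nat.le_induction with
  | base => rw [activeProb_one]; exact zero_le_one
  | succ m hm ih =>
    rw [activeProb_succ q hm]
    exact mul_nonneg ih (sub_nonneg.2 (hq m))

theorem activity_nonneg {Ω : Type*} [MeasurableSpace Ω] (p : NetworkParams) (P : Measure Ω)
    [IsProbabilityMeasure P] (N : ℕ → Ω → ℕ) (env : ℕ → ℕ → Ω → Reception p.K) {m : ℕ}
    (hm : 1 ≤ m) : 0 ≤ activity p P N env m :=
  activeProb_nonneg (fun _ => measureReal_le_one) hm

end Activity

/-! ### The reception of one user -/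

section Reception

/-- Fubini for independent random variables. -/
theorem measure_pair_mem_eq_lintegral {Ω β β' : Type*} [MeasurableSpace Ω] [MeasurableSpace β]
    [MeasurableSpace β'] {P : Measure Ω} [IsProbabilityMeasure P] {X : Ω → β} {Y : Ω → β'}
    (hX : Measurable X) (hY : Measurable Y) (h : IndepFun X Y P) {A : Set (β × β')}
    (hA : MeasurableSet A) :
    P {ω | (X ω, Y ω) ∈ A} = ∫⁻ ω', P {ω | (X ω, Y ω') ∈ A} ∂P := by
  have : IsProbabilityMeasure (P.map X) := Measure.isProbabilityMeasure_map hX.aemeasurable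
  have : IsProbabilityMeasure (P.map Y) := Measure.isProbabilityMeasure_map hY.aemeasurable
  have h1 : P {ω | (X ω, Y ω) ∈ A} = (P.map fun ω => (X ω, Y ω)) A :=
    (Measure.map_apply (hX.prodMk hY) hA).symm
  rw [h1, h.map_prod_eq_prod_map_map hX.aemeasurable hY.aemeasurable, Measure.prod_apply_symm hA,
    lintegral_map (measurable_measure_prodMk_right hA) hY]
  refine lintegral_congr fun ω' => ?_
  rw [Measure.map_apply hX (measurable_prodMk_right hA)]
  rfl

variable {Ω : Type*} [MeasurableSpace Ω] {P : Measure Ω} [IsProbabilityMeasure P]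

/-- Given the inter-cell interference, the probability that the gains of a user exceed the
(normalised) interference in all the repetitions `u`. -/
theorem measure_gains_le {K : ℕ} {X : ℕ × Fin K → Ω → ℝ} (hX : ∀ i, Measurable (X i))
    (hlaw : ∀ i, P.map (X i) = expMeasure 1) (hind : iIndepFun X P) {s : ℝ} (hs : 0 ≤ s)
    (n : ℕ) (y : Fin K → ℝ≥0∞) (u : Finset (Fin K)) :
    P {ω | ∀ r ∈ u, ∑ β ∈ Finset.Icc 1 n, ENNReal.ofReal (s * X (β, r) ω) + y r ≤
      ENNReal.ofReal (X (0, r) ω)} =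
    ENNReal.ofReal (((1 + s)⁻¹) ^ (n * u.card)) * ∏ r ∈ u, expNeg (y r) := by
  classical
  set S : Finset (ℕ × Fin K) := {0} ×ˢ Finset.univ with hS
  set T : Finset (ℕ × Fin K) := Finset.Icc 1 n ×ˢ Finset.univ with hT
  have hST : Disjoint S T := by
    rw [Finset.disjoint_left]
    rintro ⟨a, b⟩ h1 h2
    simp only [hS, hT, Finset.mem_product, Finset.mem_singleton, Finset.mem_Icc] at h1 h2
    omega
  have hI := hind.indepFun_finset S T hST hX
  have hmS : ∀ r : Fin K, ((0, r) : ℕ × Fin K) ∈ S := fun r => by simp [hS]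
  have hmT : ∀ β ∈ Finset.Icc 1 n, ∀ r : Fin K, ((β, r) : ℕ × Fin K) ∈ T := fun β hβ r => by
    rw [hT, Finset.mem_product]; exact ⟨hβ, Finset.mem_univ _⟩
  set A : Set ((S → ℝ) × (T → ℝ)) := {x | ∀ r ∈ u,
    ∑ β ∈ (Finset.Icc 1 n).attach, ENNReal.ofReal (s * x.2 ⟨(β.1, r), hmT β.1 β.2 r⟩) + y r ≤
      ENNReal.ofReal (x.1 ⟨(0, r), hmS r⟩)} with hA
  have hAm : MeasurableSet A := by
    have : A = ⋂ r ∈ u, {x | ∑ β ∈ (Finset.Icc 1 n).attach,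
        ENNReal.ofReal (s * x.2 ⟨(β.1, r), hmT β.1 β.2 r⟩) + y r ≤
          ENNReal.ofReal (x.1 ⟨(0, r), hmS r⟩)} := by
      ext x; simp [hA]
    rw [this]
    refine Finset.measurableSet_biInter _ fun r _ => measurableSet_le ?_ ?_
    · fun_prop
    · fun_prop
  have hsum : ∀ (r : Fin K) (ω : Ω), ∑ β ∈ (Finset.Icc 1 n).attach,
      ENNReal.ofReal (s * X (β.1, r) ω) =
      ∑ β ∈ Finset.Icc 1 n, ENNReal.ofReal (s * X (β, r) ω) := fun r ω =>
    Finset.sum_attach (Finset.Icc 1 n) (fun β => ENNReal.ofReal (s * X (β, r) ω))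
  have h1 := measure_pair_mem_eq_lintegral (measurable_pi_lambda _ fun i : S => hX i)
    (measurable_pi_lambda _ fun i : T => hX i) hI hAm
  simp only [hA, Set.mem_ofPred_eq, hsum] at h1
  rw [h1]
  have h2 : ∀ ω', P {ω | ∀ r ∈ u, ∑ β ∈ Finset.Icc 1 n, ENNReal.ofReal (s * X (β, r) ω') + y r ≤
      ENNReal.ofReal (X (0, r) ω)} =
      (∏ i ∈ u ×ˢ Finset.Icc 1 n, expNeg (ENNReal.ofReal (s * X (i.2, i.1) ω'))) *
        ∏ r ∈ u, expNeg (y r) := by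
    intro ω'
    have hind0 : iIndepFun (fun r : Fin K => X (0, r)) P :=
      hind.precomp (g := fun r : Fin K => ((0, r) : ℕ × Fin K)) fun a b h => (Prod.mk.inj h).2
    have h3 := hind0.measure_inter_preimage_eq_mul u
      (sets := fun r => {x : ℝ | ∑ β ∈ Finset.Icc 1 n, ENNReal.ofReal (s * X (β, r) ω') + y r ≤
        ENNReal.ofReal x}) (fun r _ => measurableSet_le measurable_const (by fun_prop))
    have h4 : {ω | ∀ r ∈ u, ∑ β ∈ Finset.Icc 1 n, ENNReal.ofReal (s * X (β, r) ω') + y r ≤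
        ENNReal.ofReal (X (0, r) ω)} = ⋂ r ∈ u, X (0, r) ⁻¹' {x : ℝ |
          ∑ β ∈ Finset.Icc 1 n, ENNReal.ofReal (s * X (β, r) ω') + y r ≤ ENNReal.ofReal x} := by
      ext ω; simp
    rw [h4, h3, Finset.prod_product, ← Finset.prod_mul_distrib]
    refine Finset.prod_congr rfl fun r _ => ?_
    rw [← Measure.map_apply (hX _) (measurableSet_le measurable_const (by fun_prop)), hlaw,
      expMeasure_one_tail, expNeg_add, expNeg_sum]
  simp_rw [h2]
  rw [lintegral_mul_const _ (Finset.measurable_prod _ fun i _ => by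
    have := hX (i.2, i.1); fun_prop)]
  congr 1
  have hind1 : iIndepFun (fun (i : Fin K × ℕ) ω =>
      expNeg (ENNReal.ofReal (s * X (i.2, i.1) ω))) P :=
    (hind.precomp (g := fun i : Fin K × ℕ => (i.2, i.1)) fun a b h =>
      Prod.ext (Prod.mk.inj h).2 (Prod.mk.inj h).1).comp
        (fun _ x => expNeg (ENNReal.ofReal (s * x))) (fun _ => by fun_prop)
  rw [lintegral_prod_eq_prod_lintegral_of_indepFun _ (fun (i : Fin K × ℕ) ω =>
      expNeg (ENNReal.ofReal (s * X (i.2, i.1) ω))) hind1 (fun i => by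
        have := hX (i.2, i.1); fun_prop)]
  have h5 : ∀ i : Fin K × ℕ, ∫⁻ ω, expNeg (ENNReal.ofReal (s * X (i.2, i.1) ω)) ∂P =
      ENNReal.ofReal (1 + s)⁻¹ := by
    intro i
    rw [← lintegral_expNeg_expMeasure_one hs, ← hlaw (i.2, i.1),
      lintegral_map (by fun_prop) (hX _)]
  simp_rw [h5]
  rw [Finset.prod_const, Finset.card_product, Nat.card_Icc, Nat.add_sub_cancel, mul_comm u.card,
    ENNReal.ofReal_pow (by positivity)]

theorem measurable_interInterference (p : NetworkParams) (m : ℕ) (r : Fin p.K) :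
    Measurable fun φ : Measure (Interferer p.K) => interInterference p m φ r := by
  refine Measure.measurable_lintegral ?_
  have h1 : Measurable fun x : Interferer p.K => x.2.1 ^ p.α := by fun_prop
  have h2 : Measurable fun x : Interferer p.K => ‖x.1‖ ^ (-p.α) := by fun_prop
  fun_prop

theorem measurable_sinr (p : NetworkParams) (m n : ℕ) (r : Fin p.K) :
    Measurable fun e : Reception p.K => sinr p m n e r := by
  have h1 : Measurable fun e : Reception p.K => interInterference p m e.2 r :=
    (measurable_interInterference p m r).comp measurable_snd
  unfold sinr intraInterference
  fun_prop

/-- The receptions from which a packet is decoded, when there are `n` other users in the cell. -/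
def decodable (p : NetworkParams) (m n : ℕ) : Set (Reception p.K) :=
  {e | ∃ r : Fin p.K, ENNReal.ofReal p.γ ≤ sinr p m n e r}

theorem measurableSet_decodable (p : NetworkParams) (m n : ℕ) :
    MeasurableSet (decodable p m n) := by
  have : decodable p m n = ⋃ r : Fin p.K, {e | ENNReal.ofReal p.γ ≤ sinr p m n e r} := by
    ext e; simp [decodable]
  rw [this]
  exact MeasurableSet.iUnion fun r => measurableSet_le measurable_const (measurable_sinr p m n r)

/-- The threshold condition, solved for the gain of the user. -/
theorem threshold_le_sinr_iff (p : NetworkParams) {m : ℕ} (hm : 1 ≤ m) (n : ℕ)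
    {e : Reception p.K} {r : Fin p.K} (he : 0 < e.1 0 r) :
    ENNReal.ofReal p.γ ≤ sinr p m n e r ↔
      ∑ β ∈ Finset.Icc 1 n, ENNReal.ofReal (p.γ * e.1 β r) +
        (ENNReal.ofReal (p.γ / (p.g m * p.ρ)) * interInterference p m e.2 r +
          ENNReal.ofReal (p.γ * p.σ ^ 2 / (p.g m * p.ρ))) ≤ ENNReal.ofReal (e.1 0 r) := by
  have hg := p.g_pos m hm
  have hρ := p.ρ_pos
  have hγ := p.γ_pos
  have hgρ : 0 < p.g m * p.ρ := mul_pos hg hρ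
  have h0 : ENNReal.ofReal (p.g m * p.ρ * e.1 0 r) ≠ 0 := by
    rw [Ne, ENNReal.ofReal_eq_zero, not_le]; positivity
  rw [sinr, ENNReal.le_div_iff_mul_le (Or.inr h0) (Or.inr ENNReal.ofReal_ne_top),
    ← ENNReal.mul_le_mul_iff_right (a := ENNReal.ofReal (p.g m * p.ρ))
      (b := _ + _) (by rw [Ne, ENNReal.ofReal_eq_zero, not_le]; exact hgρ) ENNReal.ofReal_ne_top,
    ← ENNReal.ofReal_mul hgρ.le, intraInterference, mul_add, mul_add, mul_add, mul_add,
    Finset.mul_sum, Finset.mul_sum, ← mul_assoc, ← ENNReal.ofReal_mul hgρ.le,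
    ← ENNReal.ofReal_mul hgρ.le, ← ENNReal.ofReal_mul hγ.le, add_assoc]
  have e1 : p.g m * p.ρ * (p.γ / (p.g m * p.ρ)) = p.γ := by field_simp
  have e2 : p.g m * p.ρ * (p.γ * p.σ ^ 2 / (p.g m * p.ρ)) = p.γ * p.σ ^ 2 := by field_simp
  rw [e1, e2]
  have e3 : ∀ β, ENNReal.ofReal p.γ * ENNReal.ofReal (p.g m * p.ρ * e.1 β r) =
      ENNReal.ofReal (p.g m * p.ρ) * ENNReal.ofReal (p.γ * e.1 β r) := fun β => by
    rw [← ENNReal.ofReal_mul hγ.le, ← ENNReal.ofReal_mul hgρ.le]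
    congr 1; ring
  simp_rw [e3]

/-- The stochastic reception of a user: exponential gains and an independent Poisson process of
interferers. -/
structure IsReception (p : NetworkParams) (P : Measure Ω) (lam : ℝ) (servDist : Measure ℝ)
    (e : Ω → Reception p.K) : Prop where
  measurable : Measurable e
  law_gain : ∀ β r, P.map (fun ω => (e ω).1 β r) = expMeasure 1
  indep_gain : iIndepFun (fun (i : ℕ × Fin p.K) ω => (e ω).1 i.1 i.2) P
  inter : IsPoissonProcess P (fun ω => (e ω).2) (interfererIntensity p.K lam servDist)
  indep_inter : IndepFun (fun ω => (e ω).1) (fun ω => (e ω).2) P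

variable {p : NetworkParams} {lam : ℝ} {servDist : Measure ℝ} [IsProbabilityMeasure servDist]
  {e : Ω → Reception p.K}

theorem IsReception.lintegral_interference (h : IsReception p P lam servDist e) (hlam : 0 ≤ lam)
    (hnn : ∀ᵐ R ∂servDist, 0 ≤ R)
    (hsq : ∫⁻ R, ENNReal.ofReal (R ^ 2) ∂servDist = ENNReal.ofReal (1 / (p.lamB * Real.pi)))
    {m : ℕ} (hm : 1 ≤ m) {u : Finset (Fin p.K)} (hu : u.Nonempty) :
    ∫⁻ ω, ∏ r ∈ u, expNeg (ENNReal.ofReal (p.γ / (p.g m * p.ρ)) *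
      interInterference p m (e ω).2 r) ∂P =
    ENNReal.ofReal (Real.exp (-(lam / p.lamB *
      (gaussHyp (-2 / p.α) u.card ((p.α - 2) / p.α) (-p.γ) - 1)))) := by
  have hgρ : 0 < p.g m * p.ρ := mul_pos (p.g_pos m hm) p.ρ_pos
  have hγ := p.γ_pos
  have hm0 : ∀ r : Fin p.K, Measurable fun x : Interferer p.K =>
      ENNReal.ofReal (p.γ * (x.2.1 ^ p.α * ‖x.1‖ ^ (-p.α)) * x.2.2 r) := fun r => by
    have h1 : Measurable fun x : Interferer p.K => x.2.1 ^ p.α := by fun_prop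
    have h2 : Measurable fun x : Interferer p.K => ‖x.1‖ ^ (-p.α) := by fun_prop
    fun_prop
  have h1 : ∀ ω, ∏ r ∈ u, expNeg (ENNReal.ofReal (p.γ / (p.g m * p.ρ)) *
      interInterference p m (e ω).2 r) = expNeg (∫⁻ x : Interferer p.K, ∑ r ∈ u,
        ENNReal.ofReal (p.γ * (x.2.1 ^ p.α * ‖x.1‖ ^ (-p.α)) * x.2.2 r) ∂(e ω).2) := by
    intro ω
    rw [lintegral_finsetSum _ fun r _ => hm0 r, expNeg_sum]
    refine Finset.prod_congr rfl fun r _ => ?_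
    rw [interInterference, ← lintegral_const_mul' _ _ ENNReal.ofReal_ne_top]
    congr 1
    refine lintegral_congr fun x => ?_
    rw [← ENNReal.ofReal_mul (by positivity)]
    congr 1
    have := p.g_pos m hm
    have := p.ρ_pos
    field_simp
  simp_rw [h1]
  rw [h.inter.lintegral_expNeg_lintegral (Finset.measurable_sum _ fun r _ => hm0 r),
    lintegral_interfererIntensity p.α_gt hγ hlam servDist hnn p.lamB_pos hsq hu, expNeg_ofReal]
  exact mul_nonneg (div_nonneg hlam p.lamB_pos.le)
    (sub_nonneg.2 (one_le_gaussHyp p.α_gt hγ hu.card_ne_zero))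

theorem IsReception.measure_forall_sinr (h : IsReception p P lam servDist e) (hlam : 0 ≤ lam)
    (hnn : ∀ᵐ R ∂servDist, 0 ≤ R)
    (hsq : ∫⁻ R, ENNReal.ofReal (R ^ 2) ∂servDist = ENNReal.ofReal (1 / (p.lamB * Real.pi)))
    {m : ℕ} (hm : 1 ≤ m) (n : ℕ) {u : Finset (Fin p.K)} (hu : u.Nonempty) :
    P {ω | ∀ r ∈ u, ENNReal.ofReal p.γ ≤ sinr p m n (e ω) r} = ENNReal.ofReal
      (Real.exp (-(u.card * p.γ * p.σ ^ 2 / (p.g m * p.ρ))) *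
        (1 + p.γ) ^ (-((u.card * n : ℕ) : ℤ)) *
        Real.exp (-(lam / p.lamB *
          (gaussHyp (-2 / p.α) u.card ((p.α - 2) / p.α) (-p.γ) - 1)))) := by
  have hgρ : 0 < p.g m * p.ρ := mul_pos (p.g_pos m hm) p.ρ_pos
  have hγ := p.γ_pos
  have hmgain : ∀ i : ℕ × Fin p.K, Measurable fun ω => (e ω).1 i.1 i.2 := fun i => by
    have := h.measurable
    fun_prop
  have hpos : ∀ᵐ ω ∂P, ∀ r : Fin p.K, 0 < (e ω).1 0 r := by
    rw [ae_all_iff]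
    intro r
    have h1 := ae_pos_expMeasure_one
    rw [← h.law_gain 0 r] at h1
    exact ae_of_ae_map (hmgain (0, r)).aemeasurable h1
  set y : Measure (Interferer p.K) → Fin p.K → ℝ≥0∞ := fun φ r =>
    ENNReal.ofReal (p.γ / (p.g m * p.ρ)) * interInterference p m φ r +
      ENNReal.ofReal (p.γ * p.σ ^ 2 / (p.g m * p.ρ)) with hy
  have hymeas : ∀ r, Measurable fun x : Reception p.K => y x.2 r := fun r => by
    have : Measurable fun x : Reception p.K => interInterference p m x.2 r :=
      (measurable_interInterference p m r).comp measurable_snd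
    exact (this.const_mul _).add_const _
  set A : Set (Reception p.K) := {x | ∀ r ∈ u,
    ∑ β ∈ Finset.Icc 1 n, ENNReal.ofReal (p.γ * x.1 β r) + y x.2 r ≤
      ENNReal.ofReal (x.1 0 r)} with hA
  have hAm : MeasurableSet A := by
    have : A = ⋂ r ∈ u, {x | ∑ β ∈ Finset.Icc 1 n, ENNReal.ofReal (p.γ * x.1 β r) + y x.2 r ≤
        ENNReal.ofReal (x.1 0 r)} := by
      ext x; simp [hA]
    rw [this]
    refine Finset.measurableSet_biInter _ fun r _ => measurableSet_le ?_ ?_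
    · exact Measurable.add (by fun_prop) (hymeas r)
    · fun_prop
  have h1 : P {ω | ∀ r ∈ u, ENNReal.ofReal p.γ ≤ sinr p m n (e ω) r} =
      P {ω | ((e ω).1, (e ω).2) ∈ A} := by
    refine measure_congr ?_
    filter_upwards [hpos] with ω hω
    refine propext (forall₂_congr fun r _ => ?_)
    exact threshold_le_sinr_iff p hm n (hω r)
  rw [h1, measure_pair_mem_eq_lintegral h.measurable.fst h.measurable.snd h.indep_inter hAm]
  have h2 : ∀ ω', P {ω | ((e ω).1, (e ω').2) ∈ A} =
      ENNReal.ofReal (((1 + p.γ)⁻¹) ^ (n * u.card)) *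
        (ENNReal.ofReal (Real.exp (-(p.γ * p.σ ^ 2 / (p.g m * p.ρ)))) ^ u.card *
          ∏ r ∈ u, expNeg (ENNReal.ofReal (p.γ / (p.g m * p.ρ)) *
            interInterference p m (e ω').2 r)) := by
    intro ω'
    refine (measure_gains_le hmgain (fun i => h.law_gain i.1 i.2) h.indep_gain hγ.le n
      (y (e ω').2) u).trans ?_
    congr 1
    simp only [hy, expNeg_add]
    rw [Finset.prod_mul_distrib, Finset.prod_const, mul_comm,
      expNeg_ofReal (by positivity)]
  simp_rw [h2]
  rw [lintegral_const_mul' _ _ ENNReal.ofReal_ne_top,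
    lintegral_const_mul' _ _ (ENNReal.pow_ne_top ENNReal.ofReal_ne_top),
    h.lintegral_interference hlam hnn hsq hm hu, ← ENNReal.ofReal_pow (by positivity),
    ← ENNReal.ofReal_mul (by positivity), ← ENNReal.ofReal_mul (by positivity)]
  congr 1
  rw [← Real.exp_nat_mul, zpow_neg, zpow_natCast, inv_pow, mul_comm n u.card, ← mul_assoc,
    mul_comm ((1 + p.γ) ^ (u.card * n))⁻¹]
  congr 3
  ring

theorem sum_powerset_nonempty_card {M : Type*} [AddCommMonoid M] {K : ℕ} (v : ℕ → M) :
    ∑ u ∈ (Finset.univ : Finset (Fin K)).powerset with u.Nonempty, v u.card =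
      ∑ k ∈ Finset.Icc 1 K, K.choose k • v k := by
  have h1 : ∀ u : Finset (Fin K), (if u.Nonempty then v u.card else 0) =
      (fun k => if k = 0 then 0 else v k) u.card := by
    intro u
    rcases u.eq_empty_or_nonempty with rfl | hu
    · simp
    · simp [hu, hu.ne_empty]
  rw [Finset.sum_filter, Finset.sum_congr rfl fun u _ => h1 u,
    Finset.sum_powerset_apply_card fun k => if k = 0 then 0 else v k, Finset.card_univ, Fintype.card_fin, Finset.sum_range_succ',
    Finset.range_eq_Ico, Finset.sum_Ico_add' (fun k => K.choose k • if k = 0 then 0 else v k)]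
  simp only [if_true, smul_zero, add_zero, zero_add]
  refine Finset.sum_congr rfl fun k hk => ?_
  rw [if_neg (by have := (Finset.mem_Ico.1 hk).1; omega)]

/-- The probability that the packet of a user is decoded. -/
theorem IsReception.measureReal_decodable {A : ℝ}
    (h : IsReception p P (A * p.lamA) servDist e) (hA : 0 ≤ A * p.lamA)
    (hnn : ∀ᵐ R ∂servDist, 0 ≤ R)
    (hsq : ∫⁻ R, ENNReal.ofReal (R ^ 2) ∂servDist = ENNReal.ofReal (1 / (p.lamB * Real.pi)))
    {m : ℕ} (hm : 1 ≤ m) (n : ℕ) :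
    P.real (e ⁻¹' decodable p m n) = thetaForm p A n m := by
  have hγ := p.γ_pos
  have hunion : e ⁻¹' decodable p m n = ⋃ r ∈ (Finset.univ : Finset (Fin p.K)),
      {ω | ENNReal.ofReal p.γ ≤ sinr p m n (e ω) r} := by
    ext ω; simp [decodable]
  have hmeas : ∀ r : Fin p.K, MeasurableSet {ω | ENNReal.ofReal p.γ ≤ sinr p m n (e ω) r} :=
    fun r => measurableSet_le measurable_const ((measurable_sinr p m n r).comp h.measurable)
  rw [hunion, measureReal_biUnion_eq_sum_powerset fun r _ => hmeas r]
  set v : ℕ → ℝ := fun k => (-1 : ℝ) ^ (k + 1) *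
    (Real.exp (-(k * p.γ * p.σ ^ 2 / (p.g m * p.ρ))) * (1 + p.γ) ^ (-((k * n : ℕ) : ℤ)) *
      Real.exp (-(A * p.lamA / p.lamB *
        (gaussHyp (-2 / p.α) k ((p.α - 2) / p.α) (-p.γ) - 1)))) with hv
  have h1 : ∀ u ∈ (Finset.univ : Finset (Fin p.K)).powerset.filter (·.Nonempty),
      (-1 : ℝ) ^ (u.card + 1) *
        P.real (⋂ r ∈ u, {ω | ENNReal.ofReal p.γ ≤ sinr p m n (e ω) r}) = v u.card := by
    intro u hu
    have hset : (⋂ r ∈ u, {ω | ENNReal.ofReal p.γ ≤ sinr p m n (e ω) r}) =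
        {ω | ∀ r ∈ u, ENNReal.ofReal p.γ ≤ sinr p m n (e ω) r} := by
      ext ω; simp
    rw [hset, Measure.real, h.measure_forall_sinr hA hnn hsq hm n (Finset.mem_filter.1 hu).2,
      ENNReal.toReal_ofReal (by positivity)]
  rw [Finset.sum_congr rfl h1, sum_powerset_nonempty_card v, thetaForm]
  refine Finset.sum_congr rfl fun k _ => ?_
  rw [nsmul_eq_mul, hv]
  ring

end Reception

/-! ### The access of the typical user -/

section Access

variable {Ω : Type*} {p : NetworkParams} {N : ℕ → Ω → ℕ} {env : ℕ → ℕ → Ω → Reception p.K} {m : ℕ}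

theorem numberOfUsers_inter_transmissionSuccess (n j : ℕ) :
    {ω | N m ω = n} ∩ transmissionSuccess p N env m j =
      {ω | N m ω = n} ∩ env m j ⁻¹' decodable p m n := by
  ext ω
  refine and_congr_right fun h => ?_
  have h : N m ω = n := h
  simp [transmissionSuccess, decodable, h]

theorem numberOfUsers_inter_noCollision (n : ℕ) :
    {ω | N m ω = n} ∩ noCollision p N env m =
      {ω | N m ω = n} ∩ ⋂ j ∈ Finset.Icc 1 n, env m j ⁻¹' (decodable p m n)ᶜ := by
  ext ω
  refine and_congr_right fun h => ?_
  have h : N m ω = n := h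
  simp [noCollision, transmissionSuccess, decodable, h]

theorem numberOfUsers_inter_accessSuccess (n : ℕ) :
    {ω | N m ω = n} ∩ accessSuccess p N env m =
      {ω | N m ω = n} ∩ ⋂ j ∈ Finset.range (n + 1),
        env m j ⁻¹' (if j = 0 then decodable p m n else (decodable p m n)ᶜ) := by
  have h1 : (⋂ j ∈ Finset.range (n + 1),
      env m j ⁻¹' (if j = 0 then decodable p m n else (decodable p m n)ᶜ)) =
      env m 0 ⁻¹' decodable p m n ∩ ⋂ j ∈ Finset.Icc 1 n, env m j ⁻¹' (decodable p m n)ᶜ := by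
    ext ω
    simp only [Set.mem_iInter, Set.mem_inter_iff, Finset.mem_range, Finset.mem_Icc]
    constructor
    · intro h
      refine ⟨by simpa using h 0 (by omega), fun j hj => ?_⟩
      have := h j (by omega)
      rwa [if_neg (by omega)] at this
    · rintro ⟨h0, h⟩ j hj
      rcases Nat.eq_zero_or_pos j with rfl | hj0
      · simpa using h0
      · rw [if_neg (by omega)]
        exact h j ⟨hj0, by omega⟩
  rw [h1, accessSuccess, ← Set.inter_assoc, numberOfUsers_inter_transmissionSuccess,
    Set.inter_right_comm, numberOfUsers_inter_noCollision, Set.inter_right_comm, Set.inter_assoc]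

variable [MeasurableSpace Ω] {P : Measure Ω} {ΦB : Ω → Measure Plane}

theorem IsKRepModel.isReception (h : IsKRepModel p P ΦB N env) (hm : 1 ≤ m) (j : ℕ) :
    IsReception p P (activity p P N env m * p.lamA) (P.map fun ω => nearestDist (ΦB ω))
      (env m j) where
  measurable := h.measurable_env m hm j
  law_gain := h.law_gain m hm j
  indep_gain := h.indep_gain m hm j
  inter := h.inter m hm j
  indep_inter := h.indep_inter m hm j

theorem IsKRepModel.measurableSet_number (h : IsKRepModel p P ΦB N env) (hm : 1 ≤ m) (n : ℕ) :
    MeasurableSet {ω | N m ω = n} :=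
  h.measurable_N m hm (measurableSet_singleton n)

/-- The number of users in the cell is independent of the receptions. -/
theorem IsKRepModel.measureReal_number_inter (h : IsKRepModel p P ΦB N env) (hm : 1 ≤ m)
    (n : ℕ) (s : Finset ℕ) {B : ℕ → Set (Reception p.K)} (hB : ∀ j, MeasurableSet (B j)) :
    P.real ({ω | N m ω = n} ∩ ⋂ j ∈ s, env m j ⁻¹' B j) =
      P.real {ω | N m ω = n} * ∏ j ∈ s, P.real (env m j ⁻¹' B j) := by
  have h1 := (h.indep_N m hm).measure_inter_preimage_eq_mul {n}
    (⋂ j ∈ s, (fun x : ℕ → Reception p.K => x j) ⁻¹' B j) (measurableSet_singleton n)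
    (Finset.measurableSet_biInter s fun j _ => measurable_pi_apply j (hB j))
  have h2 := (h.indep_users m hm).measure_inter_preimage_eq_mul s (sets := B) fun j _ => hB j
  have h3 : (fun ω j => env m j ω) ⁻¹' (⋂ j ∈ s, (fun x : ℕ → Reception p.K => x j) ⁻¹' B j) =
      ⋂ j ∈ s, env m j ⁻¹' B j := by
    ext ω; simp
  rw [h3, h2] at h1
  simp only [Measure.real]
  refine (congrArg ENNReal.toReal h1).trans ?_
  rw [ENNReal.toReal_mul, ENNReal.toReal_prod]
  rfl

theorem IsKRepModel.measurableSet_accessSuccess (h : IsKRepModel p P ΦB N env) (hm : 1 ≤ m)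
    (n : ℕ) : MeasurableSet ({ω | N m ω = n} ∩ accessSuccess p N env m) := by
  have hD := measurableSet_decodable p m n
  rw [numberOfUsers_inter_accessSuccess]
  refine (h.measurableSet_number hm n).inter (Finset.measurableSet_biInter _ fun j _ =>
    h.measurable_env m hm j ?_)
  split_ifs
  exacts [hD, hD.compl]

variable [IsProbabilityMeasure P]

theorem IsKRepModel.intensity_nonneg (_ : IsKRepModel p P ΦB N env) (hm : 1 ≤ m) :
    0 ≤ activity p P N env m * p.lamA :=
  mul_nonneg (activity_nonneg p P N env hm) p.lamA_nonneg

theorem IsKRepModel.measureReal_decodable (h : IsKRepModel p P ΦB N env) (hm : 1 ≤ m)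
    (n j : ℕ) :
    P.real (env m j ⁻¹' decodable p m n) = thetaForm p (activity p P N env m) n m := by
  have hmeas : Measurable fun ω => nearestDist (ΦB ω) :=
    measurable_nearestDist.comp h.base.measurable
  have : IsProbabilityMeasure (P.map fun ω => nearestDist (ΦB ω)) :=
    Measure.isProbabilityMeasure_map hmeas.aemeasurable
  refine (h.isReception hm j).measureReal_decodable (h.intensity_nonneg hm) ?_
    (h.base.lintegral_nearestDist_sq p.lamB_pos) hm n
  rw [ae_map_iff hmeas.aemeasurable measurableSet_Ici]
  exact ae_of_all _ fun ω => nearestDist_nonneg _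

theorem IsKRepModel.measureReal_compl_decodable (h : IsKRepModel p P ΦB N env) (hm : 1 ≤ m)
    (n j : ℕ) :
    P.real (env m j ⁻¹' (decodable p m n)ᶜ) = 1 - thetaForm p (activity p P N env m) n m := by
  rw [Set.preimage_compl, probReal_compl_eq_one_sub
    (h.measurable_env m hm j (measurableSet_decodable p m n)), h.measureReal_decodable hm]

theorem IsKRepModel.measureReal_number (h : IsKRepModel p P ΦB N env) (hm : 1 ≤ m) (n : ℕ) :
    P.real {ω | N m ω = n} = numberForm p (activity p P N env m) n := by
  have ha : 0 ≤ activity p P N env m * p.lamA / p.lamB :=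
    div_nonneg (h.intensity_nonneg hm) p.lamB_pos.le
  have h1 : P {ω | N m ω = n} = ENNReal.ofReal (numberForm p (activity p P N env m) n) := by
    rw [h.law_N m hm n, numberForm, ← lintegral_poisson_userCellArea ha]
    refine lintegral_congr fun x => ?_
    rw [mul_div_assoc', div_mul_eq_mul_div]
  rw [Measure.real, h1, ENNReal.toReal_ofReal (numberForm_nonneg p ha n)]

theorem IsKRepModel.measureReal_number_inter_accessSuccess (h : IsKRepModel p P ΦB N env)
    (hm : 1 ≤ m) (n : ℕ) :
    P.real ({ω | N m ω = n} ∩ accessSuccess p N env m) =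
      numberForm p (activity p P N env m) n * thetaForm p (activity p P N env m) n m *
        (1 - thetaForm p (activity p P N env m) n m) ^ n := by
  have hD := measurableSet_decodable p m n
  rw [numberOfUsers_inter_accessSuccess, h.measureReal_number_inter hm n _ fun j => by
    split_ifs
    exacts [hD, hD.compl], h.measureReal_number hm, Finset.prod_range_succ']
  simp only [Nat.add_eq_zero_iff, one_ne_zero, and_false, if_false, if_true,
    h.measureReal_compl_decodable hm, h.measureReal_decodable hm, Finset.prod_const,
    Finset.card_range]
  ring

theorem cond_real_eq_of_inter {s t : Set Ω} (hs : MeasurableSet s) (h0 : P s ≠ 0) {x : ℝ}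
    (h : P.real (s ∩ t) = P.real s * x) : (cond P s).real t = x := by
  have h1 : P.real s ≠ 0 := (measureReal_ne_zero_iff).2 h0
  rw [Measure.real, cond_apply hs, ENNReal.toReal_mul, ENNReal.toReal_inv]
  change (P.real s)⁻¹ * P.real (s ∩ t) = x
  rw [h, inv_mul_cancel_left₀ h1]

theorem IsKRepModel.hasSum_accessProb (h : IsKRepModel p P ΦB N env) (hm : 1 ≤ m) :
    HasSum (fun n : ℕ => P.real ({ω | N m ω = n} ∩ accessSuccess p N env m))
      (accessProb p P N env m) := by
  have hU : accessSuccess p N env m =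
      ⋃ n : ℕ, ({ω | N m ω = n} ∩ accessSuccess p N env m) := by
    ext ω; simp
  have h1 : P (accessSuccess p N env m) =
      ∑' n : ℕ, P ({ω | N m ω = n} ∩ accessSuccess p N env m) := by
    conv_lhs => rw [hU]
    refine measure_iUnion (fun i j hij => ?_) fun n => h.measurableSet_accessSuccess hm n
    refine Set.disjoint_left.2 fun ω h1 h2 => hij ?_
    have e1 : N m ω = i := h1.1
    have e2 : N m ω = j := h2.1
    exact e1.symm.trans e2
  have hne : ∑' n : ℕ, P ({ω | N m ω = n} ∩ accessSuccess p N env m) ≠ ∞ := by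
    rw [← h1]; exact measure_ne_top _ _
  have h2 := ENNReal.hasSum_toReal hne
  rw [← ENNReal.tsum_toReal_eq (fun n => measure_ne_top _ _), ← h1] at h2
  exact h2

end Access

theorem lemma2 {Ω : Type*} [MeasurableSpace Ω] (p : NetworkParams) (P : Measure Ω)
    [IsProbabilityMeasure P] (ΦB : Ω → Measure Plane) (N : ℕ → Ω → ℕ)
    (env : ℕ → ℕ → Ω → Reception p.K) (hmodel : IsKRepModel p P ΦB N env)
    (m : ℕ) (hm : 1 ≤ m) :
    (∀ n : ℕ, P.real {ω | N m ω = n} = numberForm p (activity p P N env m) n) ∧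
    (∀ n : ℕ, P {ω | N m ω = n} ≠ 0 →
      (cond P {ω | N m ω = n}).real (transmissionSuccess p N env m 0) =
        thetaForm p (activity p P N env m) n m ∧
      (cond P {ω | N m ω = n}).real (noCollision p N env m) =
        (1 - thetaForm p (activity p P N env m) n m) ^ n) ∧
    HasSum (fun n : ℕ => numberForm p (activity p P N env m) n *
        thetaForm p (activity p P N env m) n m *
        (1 - thetaForm p (activity p P N env m) n m) ^ n)
      (accessProb p P N env m) := by
  refine ⟨hmodel.measureReal_number hm, fun n hn => ⟨?_, ?_⟩, ?_⟩
  · refine cond_real_eq_of_inter (hmodel.measurableSet_number hm n) hn ?_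
    have h := hmodel.measureReal_number_inter hm n {0}
      (B := fun _ => decodable p m n) fun _ => measurableSet_decodable p m n
    simp only [Finset.mem_singleton, Set.iInter_iInter_eq_left, Finset.prod_singleton] at h
    rw [numberOfUsers_inter_transmissionSuccess, h, hmodel.measureReal_decodable hm]
  · refine cond_real_eq_of_inter (hmodel.measurableSet_number hm n) hn ?_
    rw [numberOfUsers_inter_noCollision, hmodel.measureReal_number_inter hm n _
      fun _ => (measurableSet_decodable p m n).compl]
    simp only [hmodel.measureReal_compl_decodable hm, Finset.prod_const, Nat.card_Icc,
      Nat.add_sub_cancel]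
  · have h := hmodel.hasSum_accessProb hm
    simp_rw [hmodel.measureReal_number_inter_accessSuccess hm] at h
    exact h
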